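/- Let $n\ge 1$, $p\ge 0$, $\mu>0$, and consider minimizing $F=f+\psi$ over $\mathbb R^p$, where $f=\frac1n\sum_{i=1}^n f_i$ is $\mu$-strongly convex, each $f_i:\mathbb R^p\to\mathbb R$ is convex and differentiable with $L_i$-Lipschitz gradient, $L_i\ge\mu$, and $\psi:\mathbb R^p\to\mathbb R\cup\{+\infty\}$ is proper, convex and lower semicontinuous. Put $F^\star=\inf F$. Let $Q=(q_1,\dots,q_n)$ be a probability distribution with all $q_i>0$, and set $$L_Q=\max_i\frac{L_i}{q_i n},\qquad \rho_Q=\frac{1}{n\min_i q_i},\qquad \eta=\min\Bigl(\frac1{12L_Q},\frac1{5\mu n}\Bigr).$$ Gradients are observed through a perturbed operator $\tilde\nabla f_i(x)=\nabla f_i(x)+\zeta$. Each perturbation $\zeta$ has zero mean given all that was drawn before the evaluation, and $\mathbb E\|\zeta\|^2\le\tilde\sigma^2$. Given step sizes $(\eta_k)_{k\ge1}$ and a starting point $x_0$, the algorithm sets $\hat x_0=x_0$ and $z_0^i=\tilde\nabla f_i(x_0)$ for all $i$. For $k\ge 1$ it samples $i_k\sim Q$ independently of the past and of the perturbations in the evaluation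 at $x_{k-1}$, and computes $$g_k=\frac1{q_{i_k}n}\bigl(\tilde\nabla f_{i_k}(x_{k-1})-z_{k-1}^{i_k}\bigr)+\frac1n\sum_{j=1}^n z^j_{k-1},$$ $$x_k=\operatorname{argmin}_y\Bigl\{\eta_k\psi(y)+\tfrac12\|y-(x_{k-1}-\eta_kg_k)\|^2\Bigr\},\qquad \hat x_k=(1-\tau_k)\hat x_{k-1}+\tau_kx_k,$$ where $\tau_k=\min\bigl(\mu\eta_k,\frac1{5n}\bigr)$. It then updates the stored gradients, with an independent random choice: * random-SVRG: with probability $1/n$, $z_k^i=\tilde\nabla f_i(x_k)$ for all $i$; otherwise $z_k^i=z_{k-1}^i$ for all $i$; * SAGA: for $j_k$ uniform in $\{1,\dots,n\}$, $z_k^{j_k}=\tilde\nabla f_{j_k}(x_k)$ and $z_k^i=z_{k-1}^i$ for $i\ne j_k$. The number of gradient evaluations is $n$ for the initialization, plus, in each iteration, one at $x_{k-1}$, one for each $z^i$ that is updated and, for random-SVRG, one more to recompute $z_{k-1}^{i_k}$ at the anchor point. Let $F(x_0)<\infty$ and $0<\varepsilon\le 24\rho_Q\eta\tilde\sigma^2$.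 Run random-SVRG or SAGA from $x_0$ with constant steps $\eta_k=\eta$ up to the first iteration $K_1$ with $\mathbb E[F(\hat x_{K_1})-F^\star]\le 24\rho_Q\eta\tilde\sigma^2$. Then restart the same algorithm from $\hat x_{K_1}$ with $\eta_k=\min\bigl(\eta,\frac{2}{\mu(k+2)}\bigr)$. Then $K_1$ exists, and there is a number $K_2$ such that in the second stage $\mathbb E[F(\hat x_k)-F^\star]\le\varepsilon$ for all $k\ge K_2$, and the expected total number of gradient evaluations in the $K_1$ iterations of the first and $K_2$ iterations of the second stage is at most $$C\Bigl(n+\frac{L_Q}{\mu}\Bigr)\max\Bigl(0,\log\frac{F(x_0)-F^\star}{\varepsilon}\Bigr)+C\,\frac{\rho_Q\tilde\sigma^2}{\mu\varepsilon},$$ where $C$ is an absolute constant (and the maximum is read as $0$ when $F(x_0)=F^\star$). -/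

import Mathlib

open MeasureTheory ProbabilityTheory
open scoped ENNReal

namespace StochasticVR

/-- The Euclidean space `ℝ^p`. -/
abbrev Vec (p : ℕ) := EuclideanSpace ℝ (Fin p)

/-- The composite problem `min F = f + ψ` with `f = (1/n) ∑ i, f i`, together with a sampling
distribution `q` on the indices. Each `f i` is convex and `L i`-smooth with `L i ≥ μ`, the average
is `μ`-strongly convex, and `ψ` is proper, convex and lower semicontinuous with values in
`ℝ ∪ {+∞}`. -/
structure FiniteSumProblem (p n : ℕ) where
  f : Fin n → Vec p → ℝ
  ψ : Vec p → EReal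
  μ : ℝ
  L : Fin n → ℝ
  q : Fin n → ℝ
  n_pos : 0 < n
  μ_pos : 0 < μ
  μ_le : ∀ i, μ ≤ L i
  f_convex : ∀ i, ConvexOn ℝ Set.univ (f i)
  f_diff : ∀ i, Differentiable ℝ (f i)
  f_smooth : ∀ i x y, ‖gradient (f i) x - gradient (f i) y‖ ≤ L i * ‖x - y‖
  f_strong : StrongConvexOn Set.univ μ (fun x => (1 / (n : ℝ)) * ∑ i, f i x)
  ψ_ne_bot : ∀ x, ψ x ≠ ⊥
  ψ_proper : ∃ x, ψ x ≠ ⊤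
  ψ_lsc : LowerSemicontinuous ψ
  ψ_convex : Convex ℝ {a : Vec p × ℝ | ψ a.1 ≤ (a.2 : EReal)}
  q_pos : ∀ i, 0 < q i
  q_sum : ∑ i, q i = 1

namespace FiniteSumProblem

variable {p n : ℕ} (A : FiniteSumProblem p n)

/-- The objective `F = f + ψ`. -/
noncomputable def F (x : Vec p) : EReal :=
  (((1 / (n : ℝ)) * ∑ i, A.f i x : ℝ) : EReal) + A.ψ x

/-- The optimal value `F⋆`. -/
noncomputable def Fstar : EReal := ⨅ x, A.F x

/-- The suboptimality `F x - F⋆`, in `[0, +∞]`. -/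
noncomputable def gap (x : Vec p) : ℝ≥0∞ := (A.F x - A.Fstar).toENNReal

/-- `L_Q = max_i L_i / (q_i n)`. -/
noncomputable def LQ : ℝ := ⨆ i, A.L i / (A.q i * n)

/-- `ρ_Q = 1 / (n min_i q_i)`. -/
noncomputable def rhoQ : ℝ := 1 / (n * ⨅ i, A.q i)

/-- The constant step size `η = min (1 / (12 L_Q), 1 / (5 μ n))`. -/
noncomputable def eta : ℝ := min (1 / (12 * A.LQ)) (1 / (5 * A.μ * n))

/-- The decreasing step sizes `η_k = min (η, 2 / (μ (k + 2)))`. -/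
noncomputable def etaDecr (k : ℕ) : ℝ := min A.eta (2 / (A.μ * (k + 2)))

end FiniteSumProblem

/-- The proximal operator: the minimizer of `y ↦ η ψ(y) + ‖y - u‖² / 2`. -/
noncomputable def prox {p : ℕ} (η : ℝ) (ψ : Vec p → EReal) (u : Vec p) : Vec p :=
  Classical.epsilon fun x => ∀ y,
    (η : EReal) * ψ x + ((‖x - u‖ ^ 2 / 2 : ℝ) : EReal) ≤
      (η : EReal) * ψ y + ((‖y - u‖ ^ 2 / 2 : ℝ) : EReal)

/-- The two gradient estimators. -/
inductive Method where
  | randomSVRG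
  | saga

/-- The random quantities drawn by the algorithm. Iteration `k ≥ 1` uses
* `idx k`, the sampled index `i_k`;
* `evalNoise k i`, the perturbation of the gradient of `f i` evaluated at `x_{k-1}`;
* `refresh k`, the set of those indices `i` for which the stored gradient `z^i` is recomputed
  at `x_k`;
* `tableNoise k i`, the perturbation of the gradient of `f i` evaluated at `x_k` when `z^i` is
  recomputed.
`tableNoise 0 i` is the perturbation in the initial value of `z^i`. -/
structure Draws (p n : ℕ) (Ω : Type*) where
  idx : ℕ → Ω → Fin n
  evalNoise : ℕ → Fin n → Ω → Vec p
  refresh : ℕ → Ω → Finset (Fin n)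
  tableNoise : ℕ → Fin n → Ω → Vec p

/-- The state of the algorithm: the iterate `x_k`, the stored perturbed gradients `z_k^i`, and the
averaged iterate. -/
structure State (p n : ℕ) where
  x : Vec p
  z : Fin n → Vec p
  xhat : Vec p

section Algorithm

variable {p n : ℕ} {Ω : Type*}

/-- The gradient estimator
`(1 / (q_i n)) (∇ f_i(x) + noise - z^i) + (1 / n) ∑ j, z^j`. -/
noncomputable def gradEstimator (A : FiniteSumProblem p n) (s : State p n) (i : Fin n)
    (noise : Vec p) : Vec p :=
  (1 / (A.q i * n)) • (gradient (A.f i) s.x + noise - s.z i) + (1 / (n : ℝ)) • ∑ j, s.z j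

/-- The algorithm with step sizes `η k` (`k ≥ 1`), started at `x0`. The averaging weight is
`τ_k = min (δ_k, 1 / (5 n))` where `δ_k = μ η_k`, which is the solution of `δ_k = η_k γ_k`,
`γ_k = (1 - δ_k) γ_{k-1} + μ δ_k` for `γ_0 = μ`. -/
noncomputable def run (A : FiniteSumProblem p n) (η : ℕ → ℝ) (x0 : Ω → Vec p)
    (D : Draws p n Ω) : ℕ → Ω → State p n
  | 0, ω =>
    { x := x0 ω
      z := fun i => gradient (A.f i) (x0 ω) + D.tableNoise 0 i ω
      xhat := x0 ω }
  | k + 1, ω =>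
    let s := run A η x0 D k ω
    let i := D.idx (k + 1) ω
    let g := gradEstimator A s i (D.evalNoise (k + 1) i ω)
    let x' := prox (η (k + 1)) A.ψ (s.x - η (k + 1) • g)
    let τ := min (A.μ * η (k + 1)) (1 / (5 * (n : ℝ)))
    { x := x'
      z := fun j => if j ∈ D.refresh (k + 1) ω
        then gradient (A.f j) x' + D.tableNoise (k + 1) j ω else s.z j
      xhat := (1 - τ) • s.xhat + τ • x' }

/-- The information available after iteration `k`: the σ-algebra generated by the starting point
and by all draws of the iterations up to `k`. -/
def history (x0 : Ω → Vec p) (D : Draws p n Ω) : ℕ → MeasurableSpace Ω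
  | 0 => MeasurableSpace.comap x0 inferInstance ⊔
      ⨆ i, MeasurableSpace.comap (D.tableNoise 0 i) inferInstance
  | k + 1 => history x0 D k ⊔
      (⨆ i, MeasurableSpace.comap (D.evalNoise (k + 1) i) inferInstance) ⊔
      MeasurableSpace.comap (D.idx (k + 1)) ⊤ ⊔
      (⨆ i, MeasurableSpace.comap (D.tableNoise (k + 1) i) inferInstance) ⊔
      MeasurableSpace.comap (D.refresh (k + 1)) ⊤

/-- The law of the set of refreshed indices. For random-SVRG all stored gradients are recomputed
(at the new anchor point) with probability `1 / n`, and none otherwise; for SAGA exactly one, of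
uniformly distributed index, is recomputed. -/
def HasRefreshLaw {mΩ : MeasurableSpace Ω} (P : Measure Ω) (S : Ω → Finset (Fin n)) :
    Method → Prop
  | .randomSVRG => (∀ ω, S ω = Finset.univ ∨ S ω = ∅) ∧
      P {ω | S ω = Finset.univ} = (n : ℝ≥0∞)⁻¹
  | .saga => (∀ ω, ∃ j, S ω = {j}) ∧ ∀ j, P {ω | S ω = {j}} = (n : ℝ≥0∞)⁻¹

/-- The probabilistic assumptions on the draws of a run started at the (possibly random) point
`x0`: indices are sampled from `q`, the refreshed sets follow the rule of the method, both
independently of everything drawn before, and all gradient perturbations have zero mean given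
everything that the point of evaluation depends on, and variance at most `σ ^ 2`. -/
structure Admissible (A : FiniteSumProblem p n) (m : Method) (σ : ℝ)
    {mΩ : MeasurableSpace Ω} (P : Measure Ω) (x0 : Ω → Vec p) (D : Draws p n Ω) : Prop where
  meas_idx : ∀ k, Measurable (D.idx k)
  meas_evalNoise : ∀ k i, Measurable (D.evalNoise k i)
  meas_refresh : ∀ k s, MeasurableSet {ω | D.refresh k ω = s}
  meas_tableNoise : ∀ k i, Measurable (D.tableNoise k i)
  /-- initial perturbations -/
  init_mean : ∀ i,
    P[D.tableNoise 0 i | MeasurableSpace.comap x0 inferInstance] =ᵐ[P] 0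
  /-- perturbations at `x_{k}` in iteration `k + 1` -/
  eval_mean : ∀ k i, P[D.evalNoise (k + 1) i | history x0 D k] =ᵐ[P] 0
  eval_var : ∀ k i, ∫⁻ ω, ‖D.evalNoise (k + 1) i ω‖ₑ ^ 2 ∂P ≤ ENNReal.ofReal (σ ^ 2)
  /-- sampled indices -/
  idx_law : ∀ k i, P {ω | D.idx (k + 1) ω = i} = ENNReal.ofReal (A.q i)
  idx_indep : ∀ k, Indep (MeasurableSpace.comap (D.idx (k + 1)) ⊤)
    (history x0 D k ⊔ ⨆ i, MeasurableSpace.comap (D.evalNoise (k + 1) i) inferInstance) P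
  /-- perturbations at `x_{k + 1}` in iteration `k + 1` -/
  table_mean : ∀ k i, P[D.tableNoise (k + 1) i | history x0 D k ⊔
    (⨆ j, MeasurableSpace.comap (D.evalNoise (k + 1) j) inferInstance) ⊔
    MeasurableSpace.comap (D.idx (k + 1)) ⊤] =ᵐ[P] 0
  table_var : ∀ k i, ∫⁻ ω, ‖D.tableNoise k i ω‖ₑ ^ 2 ∂P ≤ ENNReal.ofReal (σ ^ 2)
  /-- refreshed sets -/
  refresh_law : ∀ k, HasRefreshLaw P (D.refresh (k + 1)) m
  refresh_indep : ∀ k, Indep (MeasurableSpace.comap (D.refresh (k + 1)) ⊤)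
    (history x0 D k ⊔
      (⨆ i, MeasurableSpace.comap (D.evalNoise (k + 1) i) inferInstance) ⊔
      MeasurableSpace.comap (D.idx (k + 1)) ⊤ ⊔
      ⨆ i, MeasurableSpace.comap (D.tableNoise (k + 1) i) inferInstance) P

/-- The number of perturbed gradients `∇ f_i` evaluated by a run of `K` iterations: `n` for the
initialization, and in each iteration one at `x_{k-1}`, one per refreshed index and, for
random-SVRG, one more at the anchor point (random-SVRG keeps only the anchor point and the average
of the `z^i`, and so recomputes the `z^i` that it needs). -/
def gradEvals (m : Method) (D : Draws p n Ω) (K : ℕ) (ω : Ω) : ℕ :=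
  n + ∑ k ∈ Finset.range K,
    ((match m with
      | .randomSVRG => 2
      | .saga => 1) + (D.refresh (k + 1) ω).card)

end Algorithm

end StochasticVR

/-!
The proof tracks one Lyapunov function through both stages. Write `x⋆` for the minimizer,
`N = ρ_Q σ²`, `δ_k = μ η_k` (which equals the averaging weight `τ_k`, since `η_k ≤ 1 / (5 μ n)`),
and let `S_k` be the weighted squared distance of the stored gradients to the gradients at `x⋆`
(`tableDist`). In expectation, an iteration satisfies three inequalities.

* Descent (`IsRun.descent`): strong convexity of the proximal objective and the descent lemma give
  `η_k (F(x_k) - F⋆) + ‖x_k - x⋆‖² / 2 ≤ (1 - δ_k) ‖x_{k-1} - x⋆‖² / 2 + error`. The error is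
  linear in `g_k - ∇f(x_{k-1})` up to the shift of the proximal point caused by the noise. Comparing
  with the noiseless proximal point, whose contribution has mean zero because the estimator is
  unbiased, leaves `η_k² E‖g_k - ∇f(x_{k-1})‖²`, and this variance is at most
  `N + 4 L_Q (F(x_{k-1}) - F⋆) + 2 S_{k-1}` by co-coercivity of the gradients
  (`IsSample.integral_sq_error_le`).
* Table (`IsRun.table_recursion`): for both methods each entry is replaced with probability `1 / n`,
  so that `S_k ≤ (1 - 1/n) S_{k-1} + (1/n) (2 L_Q (F(x_k) - F⋆) + N)`. It matters for the
  constants that the new perturbations are centred and hence simply add their variance.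
* Averaging (`IsRun.averaging`): convexity of `F`.

A suitable combination of these (`energy`) contracts by `1 - δ_k` up to `21 δ_k η_k N`
(`IsRun.energy_succ`), and it starts below `8 (F(x_0) - F⋆) + 3 η N`. With the constant step it
therefore falls below `24 η N` after about `(1/δ) log ((F(x_0) - F⋆) / ε)` iterations, where
`1/δ ≤ 12 L_Q / μ + 5 n` (`IsRun.constant_step_rate`, `exists_first_stage_length`). With the
decreasing steps it is then of order `N / (μ k)` (`IsRun.decreasing_step_rate`). An iteration costs
at most three evaluations in expectation, and the fixed costs are absorbed by the noise term because
`ε ≤ 24 η N` means `1/δ ≤ 24 N / (μ ε)` (`total_cost_le`).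

Minimizers and proximal points exist by `exists_min_of_strongConvexOn`.
-/

namespace StochasticVR

/-! ### Convex analysis -/

section ConvexAnalysis

open scoped RealInnerProductSpace

lemma le_of_forall_le_add_mul {a b K : ℝ}
    (h : ∀ t : ℝ, 0 < t → t ≤ 1 → a ≤ b + t * K) : a ≤ b := by
  have h1 : Filter.Tendsto (fun t : ℝ => b + t * K) (nhdsWithin 0 (Set.Ioi 0)) (nhds b) := by
    have : ContinuousAt (fun t : ℝ => b + t * K) 0 := by fun_prop
    simpa using this.tendsto.mono_left nhdsWithin_le_nhds
  refine ge_of_tendsto h1 ?_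
  filter_upwards [Ioc_mem_nhdsGT (zero_lt_one' ℝ)] with t ht using h t ht.1 ht.2

variable {E : Type*} [NormedAddCommGroup E]

section ExtendedValued

/-- A lower semicontinuous sum `h + ψ` attains its minimum over a compact set that meets the
domain of `ψ`. -/
lemma exists_min_on_compact {ψ : E → EReal} (hbot : ∀ x, ψ x ≠ ⊥) (hlsc : LowerSemicontinuous ψ)
    {h : E → ℝ} (hc : Continuous h) {K : Set E} (hK : IsCompact K) {x₀ : E} (hx₀ : x₀ ∈ K)
    (hx₀ψ : ψ x₀ ≠ ⊤) :
    ∃ x ∈ K, ψ x ≠ ⊤ ∧ ∀ y ∈ K, ψ y ≠ ⊤ → h x + (ψ x).toReal ≤ h y + (ψ y).toReal := by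
  have hG : LowerSemicontinuous (fun x => (h x : EReal) + ψ x) := by
    refine LowerSemicontinuous.add'
      ((continuous_coe_real_ereal.comp hc).lowerSemicontinuous) hlsc fun x => ?_
    exact EReal.continuousAt_add (Or.inl (EReal.coe_ne_top _)) (Or.inl (EReal.coe_ne_bot _))
  obtain ⟨x, hxK, hx⟩ := (hG.lowerSemicontinuousOn K).exists_isMinOn ⟨x₀, hx₀⟩ hK
  have key : ∀ y, ψ y ≠ ⊤ → (h y : EReal) + ψ y = ((h y + (ψ y).toReal : ℝ) : EReal) := by
    intro y hy
    rw [EReal.coe_add, EReal.coe_toReal hy (hbot y)]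
  have hxψ : ψ x ≠ ⊤ := by
    intro htop
    have h1 := hx hx₀
    simp only [Set.mem_ofPred_eq] at h1
    rw [htop, EReal.coe_add_top, key x₀ hx₀ψ, top_le_iff] at h1
    exact EReal.coe_ne_top _ h1
  refine ⟨x, hxK, hxψ, fun y hy hyψ => ?_⟩
  have h1 := hx hy
  simp only [Set.mem_ofPred_eq] at h1
  rwa [key x hxψ, key y hyψ, EReal.coe_le_coe_iff] at h1

variable [NormedSpace ℝ E]

/-- An extended-real-valued function with convex epigraph satisfies the convexity inequality
between real values at the points where it is finite, and its domain is convex. -/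
lemma convex_toReal {ψ : E → EReal} (hbot : ∀ x, ψ x ≠ ⊥)
    (hconv : Convex ℝ {a : E × ℝ | ψ a.1 ≤ (a.2 : EReal)}) {x y : E} (hx : ψ x ≠ ⊤)
    (hy : ψ y ≠ ⊤) {a b : ℝ} (ha : 0 ≤ a) (hb : 0 ≤ b) (hab : a + b = 1) :
    ψ (a • x + b • y) ≠ ⊤ ∧
      (ψ (a • x + b • y)).toReal ≤ a * (ψ x).toReal + b * (ψ y).toReal := by
  have h := hconv (x := (x, (ψ x).toReal)) (by simp [EReal.coe_toReal hx (hbot x)])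
    (y := (y, (ψ y).toReal)) (by simp [EReal.coe_toReal hy (hbot y)]) ha hb hab
  simp only [Set.mem_ofPred_eq, Prod.smul_mk, Prod.mk_add_mk, smul_eq_mul] at h
  have h1 : ψ (a • x + b • y) ≠ ⊤ := ne_top_of_le_ne_top (EReal.coe_ne_top _) h
  refine ⟨h1, ?_⟩
  rwa [← EReal.coe_toReal h1 (hbot _), EReal.coe_le_coe_iff] at h

/-- A strongly convex proper lower semicontinuous function on a proper space has a minimizer, away
from which it grows quadratically. No affine minorant of `ψ` is needed: the minimum over a unit
ball controls the function along rays. -/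
lemma exists_min_of_strongConvexOn [ProperSpace E] {ψ : E → EReal} (hbot : ∀ x, ψ x ≠ ⊥)
    (hproper : ∃ x, ψ x ≠ ⊤) (hlsc : LowerSemicontinuous ψ)
    (hconv : Convex ℝ {a : E × ℝ | ψ a.1 ≤ (a.2 : EReal)})
    {h : E → ℝ} (hcont : Continuous h) {c : ℝ} (hc : 0 < c) (hh : StrongConvexOn Set.univ c h) :
    ∃ x, ψ x ≠ ⊤ ∧ ∀ y, ψ y ≠ ⊤ →
      h x + (ψ x).toReal + c / 2 * ‖y - x‖ ^ 2 ≤ h y + (ψ y).toReal := by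
  have sc : ∀ x y : E, ψ x ≠ ⊤ → ψ y ≠ ⊤ → ∀ t : ℝ, 0 ≤ t → t ≤ 1 →
      ψ ((1 - t) • x + t • y) ≠ ⊤ ∧
      h ((1 - t) • x + t • y) + (ψ ((1 - t) • x + t • y)).toReal ≤
        (1 - t) * (h x + (ψ x).toReal) + t * (h y + (ψ y).toReal)
          - (1 - t) * t * (c / 2 * ‖y - x‖ ^ 2) := by
    intro x y hx hy t h0 h1
    obtain ⟨h2, h3⟩ := convex_toReal hbot hconv hx hy (sub_nonneg.2 h1) h0 (by ring)
    have h4 := hh.2 (Set.mem_univ x) (Set.mem_univ y) (sub_nonneg.2 h1) h0 (by ring)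
    simp only [smul_eq_mul] at h4
    rw [norm_sub_rev x y] at h4
    exact ⟨h2, by linarith⟩
  obtain ⟨x₀, hx₀⟩ := hproper
  obtain ⟨w, -, hw, hwmin⟩ := exists_min_on_compact hbot hlsc hcont
    (isCompact_closedBall x₀ 1) (Metric.mem_closedBall_self zero_le_one) hx₀
  set v : E → ℝ := fun x => h x + (ψ x).toReal with hv
  have hD : 0 ≤ v x₀ - v w :=
    sub_nonneg.2 (hwmin x₀ (Metric.mem_closedBall_self zero_le_one) hx₀)
  set R := 1 + 2 * (v x₀ - v w) / c with hR
  have hR1 : 1 ≤ R := by rw [hR]; have : 0 ≤ 2 * (v x₀ - v w) / c := by positivity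
                         linarith
  have hx₀R : x₀ ∈ Metric.closedBall x₀ R :=
    Metric.mem_closedBall_self (zero_le_one.trans hR1)
  obtain ⟨x, -, hx, hxmin⟩ := exists_min_on_compact hbot hlsc hcont
    (isCompact_closedBall x₀ R) hx₀R hx₀
  have hglob : ∀ y, ψ y ≠ ⊤ → v x ≤ v y := by
    intro y hy
    by_cases hyR : y ∈ Metric.closedBall x₀ R
    · exact hxmin y hyR hy
    refine (hxmin x₀ hx₀R hx₀).trans ?_
    rw [Metric.mem_closedBall, dist_eq_norm, not_le] at hyR
    set r := ‖y - x₀‖ with hr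
    have hr0 : 0 < r := by linarith
    have hr1 : 1 / r ≤ 1 := by rw [div_le_one hr0]; linarith
    obtain ⟨h2, h3⟩ := sc x₀ y hx₀ hy (1 / r) (by positivity) hr1
    have hmem : (1 - 1 / r) • x₀ + (1 / r) • y ∈ Metric.closedBall x₀ 1 := by
      rw [Metric.mem_closedBall, dist_eq_norm]
      have : (1 - 1 / r) • x₀ + (1 / r) • y - x₀ = (1 / r) • (y - x₀) := by module
      rw [this, norm_smul, ← hr, Real.norm_of_nonneg (by positivity)]
      exact le_of_eq (by field_simp)
    have h4 := (hwmin _ hmem h2).trans h3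
    change v w ≤ (1 - 1 / r) * v x₀ + 1 / r * v y - (1 - 1 / r) * (1 / r) * (c / 2 * r ^ 2) at h4
    have h5 : r * v w ≤ (r - 1) * v x₀ + v y - (r - 1) * (c / 2 * r) := by
      have := mul_le_mul_of_nonneg_left h4 hr0.le
      refine this.trans (le_of_eq ?_)
      field_simp
    have h6 : 2 * (v x₀ - v w) ≤ c * (r - 1) := by
      have : 2 * (v x₀ - v w) / c ≤ r - 1 := by linarith
      rw [div_le_iff₀ hc] at this
      linarith
    change v x₀ ≤ v y
    nlinarith
  refine ⟨x, hx, fun y hy => ?_⟩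
  change v x + _ ≤ v y
  refine le_of_forall_le_add_mul (K := c / 2 * ‖y - x‖ ^ 2) fun t h0 h1 => ?_
  obtain ⟨h2, h3⟩ := sc x y hx hy t h0.le h1
  have h4 := (hglob _ h2).trans h3
  change v x ≤ (1 - t) * v x + t * v y - _ at h4
  nlinarith

end ExtendedValued

section Smooth

variable [InnerProductSpace ℝ E] [CompleteSpace E]

lemma hasDerivAt_comp_segment {f : E → ℝ} (hf : Differentiable ℝ f) (x d : E) (t : ℝ) :
    HasDerivAt (fun s : ℝ => f (x + s • d)) ⟪gradient f (x + t • d), d⟫ t := by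
  have h1 : HasDerivAt (fun s : ℝ => x + s • d) d t := by
    simpa using ((hasDerivAt_id t).smul_const d).const_add x
  exact (hf (x + t • d)).hasGradientAt.hasFDerivAt.comp_hasDerivAt t h1

/-- The descent lemma. -/
lemma descent_lemma {f : E → ℝ} (hf : Differentiable ℝ f) {L : ℝ}
    (hL : ∀ x y, ‖gradient f x - gradient f y‖ ≤ L * ‖x - y‖) (x y : E) :
    f y ≤ f x + ⟪gradient f x, y - x⟫ + L / 2 * ‖y - x‖ ^ 2 := by
  set d := y - x with hd
  let g : ℝ → ℝ := fun t => f (x + t • d) - t * ⟪gradient f x, d⟫ - L / 2 * ‖d‖ ^ 2 * t ^ 2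
  have hg : ∀ t, HasDerivAt g (⟪gradient f (x + t • d), d⟫ - ⟪gradient f x, d⟫
      - L / 2 * ‖d‖ ^ 2 * (2 * t)) t := by
    intro t
    refine ((hasDerivAt_comp_segment hf x d t).sub ?_).sub ?_
    · simpa using (hasDerivAt_id t).mul_const ⟪gradient f x, d⟫
    · simpa using (hasDerivAt_pow 2 t).const_mul (L / 2 * ‖d‖ ^ 2)
  have hanti : AntitoneOn g (Set.Icc 0 1) := by
    refine antitoneOn_of_deriv_nonpos (convex_Icc 0 1)
      (fun t _ => (hg t).continuousAt.continuousWithinAt)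
      (fun t _ => (hg t).differentiableAt.differentiableWithinAt) fun t ht => ?_
    rw [interior_Icc] at ht
    rw [(hg t).deriv, ← inner_sub_left]
    have h1 := real_inner_le_norm (gradient f (x + t • d) - gradient f x) d
    have h2 := hL (x + t • d) x
    rw [add_sub_cancel_left, norm_smul, Real.norm_of_nonneg ht.1.le] at h2
    have h3 := mul_le_mul_of_nonneg_right h2 (norm_nonneg d)
    nlinarith
  have := hanti (Set.left_mem_Icc.2 zero_le_one) (Set.right_mem_Icc.2 zero_le_one) zero_le_one
  simp only [g, one_smul, zero_smul, add_zero] at this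
  rw [hd, add_sub_cancel, ← hd] at this
  linarith

/-- First-order lower bound of a strongly convex function. -/
lemma add_inner_gradient_le_of_strongConvexOn {f : E → ℝ} {c : ℝ} (hc : StrongConvexOn Set.univ c f)
    (hf : Differentiable ℝ f) (x y : E) :
    f x + ⟪gradient f x, y - x⟫ + c / 2 * ‖y - x‖ ^ 2 ≤ f y := by
  have hd := hasDerivAt_comp_segment hf x (y - x) 0
  rw [zero_smul, add_zero] at hd
  have hslope := hd.tendsto_slope_zero_right
  have hev : ∀ᶠ t : ℝ in nhdsWithin 0 (Set.Ioi 0),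
      t⁻¹ • (f (x + (0 + t) • (y - x)) - f (x + (0 : ℝ) • (y - x)))
        ≤ f y - f x - (1 - t) * (c / 2 * ‖y - x‖ ^ 2) := by
    filter_upwards [Ioc_mem_nhdsGT (zero_lt_one' ℝ)] with t ht
    have h1 := hc.2 (Set.mem_univ x) (Set.mem_univ y) (sub_nonneg.2 ht.2) ht.1.le (by ring)
    have h2 : (1 - t) • x + t • y = x + t • (y - x) := by module
    rw [h2, norm_sub_rev x y] at h1
    simp only [smul_eq_mul] at h1
    simp only [zero_add, zero_smul, add_zero, smul_eq_mul]
    rw [inv_mul_le_iff₀ ht.1]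
    nlinarith
  have hlim : Filter.Tendsto (fun t : ℝ => f y - f x - (1 - t) * (c / 2 * ‖y - x‖ ^ 2))
      (nhdsWithin 0 (Set.Ioi 0)) (nhds (f y - f x - c / 2 * ‖y - x‖ ^ 2)) := by
    have : ContinuousAt (fun t : ℝ => f y - f x - (1 - t) * (c / 2 * ‖y - x‖ ^ 2)) 0 := by fun_prop
    simpa using this.tendsto.mono_left nhdsWithin_le_nhds
  have := le_of_tendsto_of_tendsto hslope hlim hev
  linarith

/-- Co-coercivity: for a convex function with Lipschitz gradient, squared gradient differences are
bounded by the Bregman divergence. The bound compares the function at `y` with its values after a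
gradient step from `x`. -/
lemma norm_gradient_sub_sq_le {f : E → ℝ} (hconv : ConvexOn ℝ Set.univ f)
    (hf : Differentiable ℝ f) {L : ℝ} (hLpos : 0 < L)
    (hL : ∀ x y, ‖gradient f x - gradient f y‖ ≤ L * ‖x - y‖) (x y : E) :
    ‖gradient f x - gradient f y‖ ^ 2 ≤ 2 * L * (f x - f y - ⟪gradient f y, x - y⟫) := by
  set v := gradient f x - gradient f y with hv
  have h1 := descent_lemma hf hL x (x - (1 / L) • v)
  have h2 := add_inner_gradient_le_of_strongConvexOn (strongConvexOn_zero.2 hconv) hf y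
    (x - (1 / L) • v)
  have e1 : x - (1 / L) • v - x = -((1 / L) • v) := by abel
  have e2 : x - (1 / L) • v - y = (x - y) - (1 / L) • v := by abel
  rw [e1, norm_neg, norm_smul, inner_neg_right, inner_smul_right,
    Real.norm_of_nonneg (by positivity)] at h1
  rw [e2, inner_sub_right, inner_smul_right] at h2
  have h3 : ⟪gradient f x, v⟫ - ⟪gradient f y, v⟫ = ‖v‖ ^ 2 := by
    rw [← inner_sub_left, ← hv, real_inner_self_eq_norm_sq]
  have h4 : L / 2 * (1 / L * ‖v‖) ^ 2 = 1 / L * ‖v‖ ^ 2 / 2 := by field_simp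
  have h5 : 1 / L * ‖v‖ ^ 2 / 2 ≤ f x - f y - ⟪gradient f y, x - y⟫ := by
    have : 1 / L * ‖v‖ ^ 2 = 1 / L * ⟪gradient f x, v⟫ - 1 / L * ⟪gradient f y, v⟫ := by
      rw [← h3]; ring
    nlinarith
  calc ‖v‖ ^ 2 = 2 * L * (1 / L * ‖v‖ ^ 2 / 2) := by field_simp
    _ ≤ _ := by gcongr

end Smooth

end ConvexAnalysis

/-! ### The composite problem -/

namespace FiniteSumProblem

open scoped RealInnerProductSpace

variable {p n : ℕ}

lemma cast_n_pos (A : FiniteSumProblem p n) : (0 : ℝ) < n := Nat.cast_pos.2 A.n_pos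

variable (A : FiniteSumProblem p n)

lemma L_pos (i : Fin n) : 0 < A.L i := A.μ_pos.trans_le (A.μ_le i)

lemma qn_pos (i : Fin n) : 0 < A.q i * n := mul_pos (A.q_pos i) A.cast_n_pos

lemma div_qn_le_LQ (i : Fin n) : A.L i / (A.q i * n) ≤ A.LQ :=
  le_ciSup (f := fun i => A.L i / (A.q i * n)) (Set.finite_range _).bddAbove i

lemma L_le (i : Fin n) : A.L i ≤ A.LQ * (A.q i * n) :=
  (div_le_iff₀ (A.qn_pos i)).1 (A.div_qn_le_LQ i)

lemma LQ_pos : 0 < A.LQ :=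
  (div_pos (A.L_pos ⟨0, A.n_pos⟩) (A.qn_pos ⟨0, A.n_pos⟩)).trans_le (A.div_qn_le_LQ _)

lemma rhoQ_pos_and_le : 0 < A.rhoQ ∧ ∀ i, 1 / (A.q i * n) ≤ A.rhoQ := by
  have : Nonempty (Fin n) := ⟨⟨0, A.n_pos⟩⟩
  obtain ⟨j, hj⟩ := exists_eq_ciInf_of_finite (f := A.q)
  have h : A.rhoQ = 1 / (n * A.q j) := by rw [rhoQ, ← hj]
  refine ⟨by rw [h]; exact one_div_pos.2 (mul_pos A.cast_n_pos (A.q_pos j)), fun i => ?_⟩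
  rw [h, mul_comm (A.q i)]
  have h2 : A.q j ≤ A.q i := by rw [hj]; exact ciInf_le (Set.finite_range _).bddBelow i
  exact one_div_le_one_div_of_le (mul_pos A.cast_n_pos (A.q_pos j))
    (mul_le_mul_of_nonneg_left h2 A.cast_n_pos.le)

lemma eta_pos : 0 < A.eta := by
  have := A.LQ_pos; have := A.cast_n_pos; have := A.μ_pos
  exact lt_min (by positivity) (by positivity)

lemma eta_mul_LQ_le : A.eta * A.LQ ≤ 1 / 12 := by
  have h := A.LQ_pos
  calc A.eta * A.LQ ≤ 1 / (12 * A.LQ) * A.LQ := by gcongr; exact min_le_left _ _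
    _ = 1 / 12 := by field_simp

lemma mu_mul_eta_mul_n_le : A.μ * A.eta * n ≤ 1 / 5 := by
  have h := A.cast_n_pos; have h' := A.μ_pos
  calc A.μ * A.eta * n ≤ A.μ * (1 / (5 * A.μ * n)) * n := by gcongr; exact min_le_right _ _
    _ = 1 / 5 := by field_simp

/-- The smooth part `f = (1/n) ∑ i, f i` of the objective. -/
noncomputable def smoothPart (x : Vec p) : ℝ := (1 / (n : ℝ)) * ∑ i, A.f i x

/-- The gradient of the smooth part, as the average of the component gradients. -/
noncomputable def gradAvg (x : Vec p) : Vec p := (1 / (n : ℝ)) • ∑ i, gradient (A.f i) x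

lemma hasGradientAt_smoothPart (x : Vec p) : HasGradientAt A.smoothPart (A.gradAvg x) x := by
  have h1 : HasFDerivAt A.smoothPart
      ((1 / (n : ℝ)) • ∑ i, (InnerProductSpace.toDual ℝ (Vec p)) (gradient (A.f i) x)) x := by
    unfold smoothPart
    refine HasFDerivAt.const_mul (HasFDerivAt.fun_sum fun i _ => ?_) _
    exact (A.f_diff i x).hasGradientAt.hasFDerivAt
  have e : InnerProductSpace.toDual ℝ (Vec p) (A.gradAvg x)
      = (1 / (n : ℝ)) • ∑ i, (InnerProductSpace.toDual ℝ (Vec p)) (gradient (A.f i) x) := by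
    simp [gradAvg]
  rw [hasGradientAt_iff_hasFDerivAt, e]
  exact h1

lemma differentiable_smoothPart : Differentiable ℝ A.smoothPart :=
  fun x => (A.hasGradientAt_smoothPart x).differentiableAt

lemma gradient_smoothPart (x : Vec p) : gradient A.smoothPart x = A.gradAvg x :=
  (A.hasGradientAt_smoothPart x).gradient

lemma lipschitzWith_gradient (i : Fin n) :
    LipschitzWith (A.L i).toNNReal (gradient (A.f i)) :=
  LipschitzWith.of_dist_le_mul fun x y => by
    rw [dist_eq_norm, dist_eq_norm, Real.coe_toNNReal _ (A.L_pos i).le]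
    exact A.f_smooth i x y

lemma norm_gradient_smoothPart_sub_le (x y : Vec p) :
    ‖gradient A.smoothPart x - gradient A.smoothPart y‖ ≤ A.LQ * ‖x - y‖ := by
  have hn := A.cast_n_pos
  rw [gradient_smoothPart, gradient_smoothPart, gradAvg, gradAvg, ← smul_sub,
    ← Finset.sum_sub_distrib, norm_smul, Real.norm_of_nonneg (by positivity)]
  calc 1 / (n : ℝ) * ‖∑ i, (gradient (A.f i) x - gradient (A.f i) y)‖
      ≤ 1 / (n : ℝ) * ∑ i, A.LQ * (A.q i * n) * ‖x - y‖ := by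
        gcongr
        refine norm_sum_le_of_le _ fun i _ => (A.f_smooth i x y).trans ?_
        gcongr
        exact A.L_le i
    _ = A.LQ * ‖x - y‖ := by
        rw [← Finset.sum_mul, ← Finset.mul_sum, ← Finset.sum_mul, A.q_sum]
        field_simp

/-- The real value of the objective `F`, meaningful on the domain of `ψ`. -/
noncomputable def objective (x : Vec p) : ℝ := A.smoothPart x + (A.ψ x).toReal

lemma F_eq {x : Vec p} (hx : A.ψ x ≠ ⊤) : A.F x = (A.objective x : EReal) := by
  rw [F, objective, EReal.coe_add, EReal.coe_toReal hx (A.ψ_ne_bot x)]; rfl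

lemma exists_minimizer : ∃ x, A.ψ x ≠ ⊤ ∧ ∀ y, A.ψ y ≠ ⊤ →
    A.objective x + A.μ / 2 * ‖y - x‖ ^ 2 ≤ A.objective y :=
  exists_min_of_strongConvexOn A.ψ_ne_bot A.ψ_proper A.ψ_lsc A.ψ_convex
    A.differentiable_smoothPart.continuous A.μ_pos A.f_strong

/-- The minimizer of the objective. -/
noncomputable def xstar : Vec p := A.exists_minimizer.choose

lemma xstar_mem : A.ψ A.xstar ≠ ⊤ := A.exists_minimizer.choose_spec.1

/-- The real suboptimality `F x - F⋆`, meaningful on the domain of `ψ`. -/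
noncomputable def subopt (x : Vec p) : ℝ := A.objective x - A.objective A.xstar

lemma sq_dist_xstar_le {x : Vec p} (hx : A.ψ x ≠ ⊤) :
    A.μ / 2 * ‖x - A.xstar‖ ^ 2 ≤ A.subopt x := by
  have := A.exists_minimizer.choose_spec.2 x hx
  unfold subopt xstar; linarith

lemma subopt_nonneg {x : Vec p} (hx : A.ψ x ≠ ⊤) : 0 ≤ A.subopt x :=
  le_trans (by have := A.μ_pos; positivity) (A.sq_dist_xstar_le hx)

lemma Fstar_eq : A.Fstar = (A.objective A.xstar : EReal) := by
  refine le_antisymm ((iInf_le _ A.xstar).trans_eq (A.F_eq A.xstar_mem)) (le_iInf fun y => ?_)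
  by_cases hy : A.ψ y = ⊤
  · rw [F, hy, EReal.coe_add_top]; exact le_top
  · rw [A.F_eq hy, EReal.coe_le_coe_iff]
    exact sub_nonneg.1 (A.subopt_nonneg hy)

lemma gap_eq {x : Vec p} (hx : A.ψ x ≠ ⊤) : A.gap x = ENNReal.ofReal (A.subopt x) := by
  rw [gap, A.F_eq hx, Fstar_eq, ← EReal.coe_sub, EReal.toENNReal_of_ne_top (EReal.coe_ne_top _),
    EReal.toReal_coe, subopt]

lemma smoothPart_convex : ConvexOn ℝ Set.univ A.smoothPart :=
  UniformConvexOn.convexOn A.f_strong fun r => by have := A.μ_pos; positivity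

/-- Convexity of the objective along a segment in the domain. -/
lemma subopt_convex {x y : Vec p} (hx : A.ψ x ≠ ⊤) (hy : A.ψ y ≠ ⊤) {t : ℝ} (h0 : 0 ≤ t)
    (h1 : t ≤ 1) : A.ψ ((1 - t) • x + t • y) ≠ ⊤ ∧
      A.subopt ((1 - t) • x + t • y) ≤ (1 - t) * A.subopt x + t * A.subopt y := by
  obtain ⟨h2, h3⟩ := convex_toReal A.ψ_ne_bot A.ψ_convex hx hy (sub_nonneg.2 h1) h0 (by ring)
  have h4 := A.smoothPart_convex.2 (Set.mem_univ x) (Set.mem_univ y) (sub_nonneg.2 h1) h0 (by ring)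
  simp only [smul_eq_mul] at h4
  refine ⟨h2, ?_⟩
  unfold subopt objective
  linarith

/-- Optimality of `x⋆` (that is, `-∇f(x⋆) ∈ ∂ψ(x⋆)`): the Bregman divergence of the smooth part at
`x⋆` is at most the suboptimality. -/
lemma bregman_le_subopt {x : Vec p} (hx : A.ψ x ≠ ⊤) :
    A.smoothPart x - A.smoothPart A.xstar - ⟪A.gradAvg A.xstar, x - A.xstar⟫ ≤ A.subopt x := by
  set d := x - A.xstar with hd
  refine le_of_forall_le_add_mul (K := A.LQ / 2 * ‖d‖ ^ 2) fun t h0 h1 => ?_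
  have hmem := convex_toReal A.ψ_ne_bot A.ψ_convex A.xstar_mem hx (sub_nonneg.2 h1) h0.le (by ring)
  have h2 := A.subopt_nonneg hmem.1
  have e : (1 - t) • A.xstar + t • x = A.xstar + t • d := by rw [hd]; module
  have h3 := descent_lemma A.differentiable_smoothPart A.norm_gradient_smoothPart_sub_le
    A.xstar (A.xstar + t • d)
  rw [add_sub_cancel_left, inner_smul_right, norm_smul, Real.norm_of_nonneg h0.le,
    gradient_smoothPart] at h3
  have h4 := hmem.2
  rw [e] at h2 h4
  unfold subopt objective at h2 ⊢
  have h5 : 0 ≤ t * (⟪A.gradAvg A.xstar, d⟫ + t * (A.LQ / 2 * ‖d‖ ^ 2)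
      + (A.ψ x).toReal - (A.ψ A.xstar).toReal) := by nlinarith
  have h6 := nonneg_of_mul_nonneg_right h5 h0
  linarith

/-- The weighted squared distance of a table `v` of component gradients to the gradients at
`x⋆`. -/
noncomputable def tableDist (v : Fin n → Vec p) : ℝ :=
  (1 / (n : ℝ)) * ∑ i, 1 / (A.q i * n) * ‖v i - gradient (A.f i) A.xstar‖ ^ 2

lemma tableDist_gradient_le {x : Vec p} (hx : A.ψ x ≠ ⊤) :
    A.tableDist (fun i => gradient (A.f i) x) ≤ 2 * A.LQ * A.subopt x := by
  have hn := A.cast_n_pos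
  have hL := A.LQ_pos
  calc A.tableDist (fun i => gradient (A.f i) x)
      ≤ 1 / (n : ℝ) * ∑ i, 2 * A.LQ * (A.f i x - A.f i A.xstar
          - ⟪gradient (A.f i) A.xstar, x - A.xstar⟫) := by
        unfold tableDist
        refine mul_le_mul_of_nonneg_left (Finset.sum_le_sum fun i _ => ?_) (by positivity)
        have hq := A.qn_pos i
        have h := norm_gradient_sub_sq_le (A.f_convex i) (A.f_diff i) (A.L_pos i) (A.f_smooth i)
          x A.xstar
        have h0 : 0 ≤ A.f i x - A.f i A.xstar - ⟪gradient (A.f i) A.xstar, x - A.xstar⟫ := by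
          have := add_inner_gradient_le_of_strongConvexOn (strongConvexOn_zero.2 (A.f_convex i))
            (A.f_diff i) A.xstar x
          linarith
        calc _ ≤ 1 / (A.q i * n) * (2 * A.L i * (A.f i x - A.f i A.xstar
              - ⟪gradient (A.f i) A.xstar, x - A.xstar⟫)) := by gcongr
          _ = 2 * (A.L i / (A.q i * n)) * (A.f i x - A.f i A.xstar
              - ⟪gradient (A.f i) A.xstar, x - A.xstar⟫) := by ring
          _ ≤ _ := by gcongr; exact A.div_qn_le_LQ i
    _ = 2 * A.LQ * (A.smoothPart x - A.smoothPart A.xstar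
          - ⟪A.gradAvg A.xstar, x - A.xstar⟫) := by
        rw [← Finset.mul_sum, Finset.sum_sub_distrib, Finset.sum_sub_distrib]
        unfold smoothPart gradAvg
        rw [inner_smul_left, sum_inner]
        simp only [conj_trivial]
        ring
    _ ≤ _ := by gcongr; exact A.bregman_le_subopt hx

/-! ### The proximal step -/

/-- The defining property of the proximal point: it lies in the domain, and the proximal objective
grows quadratically away from it. -/
lemma prox_spec {η : ℝ} (hη : 0 < η) (u : Vec p) :
    A.ψ (prox η A.ψ u) ≠ ⊤ ∧ ∀ y, A.ψ y ≠ ⊤ →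
      η * (A.ψ (prox η A.ψ u)).toReal + ‖prox η A.ψ u - u‖ ^ 2 / 2
        + ‖y - prox η A.ψ u‖ ^ 2 / 2 ≤ η * (A.ψ y).toReal + ‖y - u‖ ^ 2 / 2 := by
  have hcont : Continuous fun y : Vec p => 1 / η * (‖y - u‖ ^ 2 / 2) := by fun_prop
  have hsc : StrongConvexOn Set.univ (1 / η) fun y : Vec p => 1 / η * (‖y - u‖ ^ 2 / 2) := by
    refine ⟨convex_univ, fun x _ y _ a b ha hb hab => le_of_eq ?_⟩
    have e : a • x + b • y - u = a • (x - u) + b • (y - u) := by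
      obtain rfl := eq_sub_of_add_eq hab
      module
    have e' : x - y = (x - u) - (y - u) := by abel
    beta_reduce
    rw [e, e', norm_add_sq_real, norm_sub_sq_real (x - u), norm_smul, norm_smul,
      real_inner_smul_left, real_inner_smul_right, Real.norm_of_nonneg ha, Real.norm_of_nonneg hb]
    obtain rfl := eq_sub_of_add_eq hab
    simp only [smul_eq_mul]
    ring
  obtain ⟨x, hx, hmin⟩ := exists_min_of_strongConvexOn A.ψ_ne_bot A.ψ_proper A.ψ_lsc A.ψ_convex
    hcont (one_div_pos.2 hη) hsc
  have hmin' : ∀ y, A.ψ y ≠ ⊤ → η * (A.ψ x).toReal + ‖x - u‖ ^ 2 / 2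
      + ‖y - x‖ ^ 2 / 2 ≤ η * (A.ψ y).toReal + ‖y - u‖ ^ 2 / 2 := by
    intro y hy
    have h := mul_le_mul_of_nonneg_left (hmin y hy) hη.le
    have e1 : η * (1 / η * (‖x - u‖ ^ 2 / 2) + (A.ψ x).toReal + 1 / η / 2 * ‖y - x‖ ^ 2)
        = η * (A.ψ x).toReal + ‖x - u‖ ^ 2 / 2 + ‖y - x‖ ^ 2 / 2 := by field_simp; ring
    have e2 : η * (1 / η * (‖y - u‖ ^ 2 / 2) + (A.ψ y).toReal)
        = η * (A.ψ y).toReal + ‖y - u‖ ^ 2 / 2 := by field_simp; ring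
    rwa [e1, e2] at h
  have key : ∀ y, A.ψ y ≠ ⊤ → (η : EReal) * A.ψ y + ((‖y - u‖ ^ 2 / 2 : ℝ) : EReal)
      = ((η * (A.ψ y).toReal + ‖y - u‖ ^ 2 / 2 : ℝ) : EReal) := by
    intro y hy
    rw [EReal.coe_add, EReal.coe_mul, EReal.coe_toReal hy (A.ψ_ne_bot y)]
  have keyt : ∀ y, A.ψ y = ⊤ → (η : EReal) * A.ψ y + ((‖y - u‖ ^ 2 / 2 : ℝ) : EReal) = ⊤ := by
    intro y hy
    rw [hy, EReal.coe_mul_top_of_pos hη, EReal.top_add_coe]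
  have hex : ∃ x : Vec p, ∀ y, (η : EReal) * A.ψ x + ((‖x - u‖ ^ 2 / 2 : ℝ) : EReal) ≤
      (η : EReal) * A.ψ y + ((‖y - u‖ ^ 2 / 2 : ℝ) : EReal) := by
    refine ⟨x, fun y => ?_⟩
    by_cases hy : A.ψ y = ⊤
    · rw [keyt y hy]; exact le_top
    · rw [key x hx, key y hy, EReal.coe_le_coe_iff]
      refine le_trans ?_ (hmin' y hy)
      have : 0 ≤ ‖y - x‖ ^ 2 / 2 := by positivity
      linarith
  have hspec : ∀ y, (η : EReal) * A.ψ (prox η A.ψ u)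
      + ((‖prox η A.ψ u - u‖ ^ 2 / 2 : ℝ) : EReal) ≤
      (η : EReal) * A.ψ y + ((‖y - u‖ ^ 2 / 2 : ℝ) : EReal) := Classical.epsilon_spec hex
  have hdom : A.ψ (prox η A.ψ u) ≠ ⊤ := by
    intro htop
    have h := hspec x
    rw [keyt _ htop, key x hx, top_le_iff] at h
    exact EReal.coe_ne_top _ h
  have heq : prox η A.ψ u = x := by
    have h1 := hspec x
    rw [key _ hdom, key x hx, EReal.coe_le_coe_iff] at h1
    have h2 := hmin' _ hdom
    have h3 : ‖prox η A.ψ u - x‖ ^ 2 ≤ 0 := by linarith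
    have h4 : ‖prox η A.ψ u - x‖ = 0 := by nlinarith [norm_nonneg (prox η A.ψ u - x)]
    exact sub_eq_zero.1 (norm_eq_zero.1 h4)
  rw [heq]
  exact ⟨hx, hmin'⟩

lemma prox_mem {η : ℝ} (hη : 0 < η) (u : Vec p) : A.ψ (prox η A.ψ u) ≠ ⊤ :=
  (A.prox_spec hη u).1

lemma norm_prox_sub_le {η : ℝ} (hη : 0 < η) (u v : Vec p) :
    ‖prox η A.ψ u - prox η A.ψ v‖ ≤ ‖u - v‖ := by
  set x := prox η A.ψ u with hx
  set y := prox η A.ψ v with hy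
  have h1 := (A.prox_spec hη u).2 y (A.prox_mem hη v)
  have h2 := (A.prox_spec hη v).2 x (A.prox_mem hη u)
  rw [← hx] at h1
  rw [← hy] at h2
  have h3 : ‖x - y‖ ^ 2 ≤ ⟪x - y, u - v⟫ := by
    have e1 : ‖y - u‖ ^ 2 - ‖x - u‖ ^ 2 + ‖x - v‖ ^ 2 - ‖y - v‖ ^ 2 = 2 * ⟪x - y, u - v⟫ := by
      simp only [norm_sub_sq_real, inner_sub_left, inner_sub_right]
      ring
    rw [norm_sub_rev y x] at h1
    linarith
  have h4 := real_inner_le_norm (x - y) (u - v)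
  by_contra! h5
  nlinarith [norm_nonneg (x - y), norm_nonneg (u - v)]

lemma lipschitzWith_prox {η : ℝ} (hη : 0 < η) : LipschitzWith 1 (prox η A.ψ) :=
  LipschitzWith.of_dist_le_mul fun u v => by
    simpa [dist_eq_norm] using A.norm_prox_sub_le hη u v

/-- One proximal step with an arbitrary gradient estimate `g`. The error term is split at the
noiseless proximal point, so that its first part is linear in the error `g - ∇f(x)` with a
coefficient that does not depend on `g`. -/
lemma prox_step {η : ℝ} (hη : 0 < η) (hηL : η * A.LQ ≤ 1) (x g : Vec p) :
    η * A.subopt (prox η A.ψ (x - η • g)) + ‖prox η A.ψ (x - η • g) - A.xstar‖ ^ 2 / 2 ≤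
      (1 - A.μ * η) * (‖x - A.xstar‖ ^ 2 / 2)
        + η * ⟪A.xstar - prox η A.ψ (x - η • A.gradAvg x), g - A.gradAvg x⟫
        + η ^ 2 * ‖g - A.gradAvg x‖ ^ 2 := by
  set x' := prox η A.ψ (x - η • g) with hx'
  set w := prox η A.ψ (x - η • A.gradAvg x) with hw
  have h1 := (A.prox_spec hη (x - η • g)).2 A.xstar A.xstar_mem
  rw [← hx'] at h1
  have hd := descent_lemma A.differentiable_smoothPart A.norm_gradient_smoothPart_sub_le x x'
  have hs := add_inner_gradient_le_of_strongConvexOn A.f_strong A.differentiable_smoothPart x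
    A.xstar
  change A.smoothPart x + ⟪gradient A.smoothPart x, A.xstar - x⟫ + _ ≤ A.smoothPart A.xstar at hs
  rw [gradient_smoothPart] at hd hs
  have hwx : ⟪w - x', g - A.gradAvg x⟫ ≤ η * ‖g - A.gradAvg x‖ ^ 2 := by
    refine (real_inner_le_norm _ _).trans ?_
    have h2 := A.norm_prox_sub_le hη (x - η • A.gradAvg x) (x - η • g)
    rw [← hx', ← hw] at h2
    have e : x - η • A.gradAvg x - (x - η • g) = η • (g - A.gradAvg x) := by module
    rw [e, norm_smul, Real.norm_of_nonneg hη.le] at h2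
    calc _ ≤ η * ‖g - A.gradAvg x‖ * ‖g - A.gradAvg x‖ := by gcongr
      _ = _ := by ring
  have e1 : ‖x' - (x - η • g)‖ ^ 2 = ‖x' - x‖ ^ 2 + 2 * η * ⟪g, x' - x⟫ + η ^ 2 * ‖g‖ ^ 2 := by
    have : x' - (x - η • g) = (x' - x) + η • g := by abel
    rw [this, norm_add_sq_real, real_inner_smul_right, norm_smul, Real.norm_of_nonneg hη.le,
      real_inner_comm]
    ring
  have e2 : ‖A.xstar - (x - η • g)‖ ^ 2
      = ‖A.xstar - x‖ ^ 2 + 2 * η * ⟪g, A.xstar - x⟫ + η ^ 2 * ‖g‖ ^ 2 := by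
    have : A.xstar - (x - η • g) = (A.xstar - x) + η • g := by abel
    rw [this, norm_add_sq_real, real_inner_smul_right, norm_smul, Real.norm_of_nonneg hη.le,
      real_inner_comm]
    ring
  have e3 : ⟪A.xstar - x', g - A.gradAvg x⟫
      = ⟪g, A.xstar - x⟫ - ⟪A.gradAvg x, A.xstar - x⟫ - ⟪g, x' - x⟫ + ⟪A.gradAvg x, x' - x⟫ := by
    have : A.xstar - x' = (A.xstar - x) - (x' - x) := by abel
    rw [this, real_inner_comm]
    simp only [inner_sub_left, inner_sub_right]
    ring
  have e4 : ⟪A.xstar - x', g - A.gradAvg x⟫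
      = ⟪A.xstar - w, g - A.gradAvg x⟫ + ⟪w - x', g - A.gradAvg x⟫ := by
    rw [← inner_add_left]; congr 1; abel
  rw [e1, e2] at h1
  rw [norm_sub_rev A.xstar x] at h1 hs
  rw [norm_sub_rev A.xstar x'] at h1
  have h5 : A.LQ / 2 * ‖x' - x‖ ^ 2 * η ≤ ‖x' - x‖ ^ 2 / 2 := by
    nlinarith [sq_nonneg ‖x' - x‖]
  have hd' := mul_le_mul_of_nonneg_left hd hη.le
  have hs' := mul_le_mul_of_nonneg_left hs hη.le
  have hwx' := mul_le_mul_of_nonneg_left hwx hη.le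
  have e5 := e3.symm.trans e4
  have e6 : η * (⟪g, A.xstar - x⟫ - ⟪A.gradAvg x, A.xstar - x⟫ - ⟪g, x' - x⟫
      + ⟪A.gradAvg x, x' - x⟫) = η * (⟪A.xstar - w, g - A.gradAvg x⟫
      + ⟪w - x', g - A.gradAvg x⟫) := by rw [e5]
  unfold subopt objective
  nlinarith

end FiniteSumProblem

/-! ### Independent draws and centred perturbations -/

section Probability

open scoped RealInnerProductSpace

variable {Ω : Type*} {mΩ : MeasurableSpace Ω} {P : Measure Ω}

/-- Over an event independent of `m`, an `m`-measurable function integrates to the product of the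
probability of the event and the full integral. -/
lemma setIntegral_eq_mul_of_indep [IsProbabilityMeasure P] {m m' : MeasurableSpace Ω}
    (hm : m ≤ mΩ) (hm' : m' ≤ mΩ) (hind : Indep m' m P) {T : Set Ω} (hT : MeasurableSet[m'] T)
    {f : Ω → ℝ} (hf : Measurable[m] f) (hfi : Integrable f P) :
    ∫ ω in T, f ω ∂P = P.real T * ∫ ω, f ω ∂P := by
  rw [← setIntegral_condExp hm' hfi hT, setIntegral_congr_ae (g := fun _ => ∫ ω, f ω ∂P) (hm' _ hT),
    setIntegral_const, smul_eq_mul]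
  filter_upwards [condExp_indep_eq hm hm' hf.stronglyMeasurable hind.symm] with ω hω _ using hω

section Draw

variable {ι : Type*} [Fintype ι] {I : Ω → ι}

lemma comp_draw_eq_sum_indicator {F : Type*} [AddCommMonoid F] (I : Ω → ι) (φ : ι → Ω → F) :
    (fun ω => φ (I ω) ω) = fun ω => ∑ i, (I ⁻¹' {i}).indicator (φ i) ω := by
  funext ω
  rw [Finset.sum_eq_single (I ω)]
  · simp
  · intro i _ hi
    simp [Set.indicator, hi.symm]
  · simp

lemma memLp_comp_draw {F : Type*} [NormedAddCommGroup F] {φ : ι → Ω → F}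
    (hI : ∀ i, MeasurableSet (I ⁻¹' {i})) {r : ℝ≥0∞} (hφ : ∀ i, MemLp (φ i) r P) :
    MemLp (fun ω => φ (I ω) ω) r P := by
  rw [comp_draw_eq_sum_indicator]
  exact memLp_finsetSum _ fun i _ => (hφ i).indicator (hI i)

/-- Expectation of a function of an independent draw from a finite set. -/
lemma integral_comp_draw [IsProbabilityMeasure P] {m : MeasurableSpace Ω} {φ : ι → Ω → ℝ}
    (hm : m ≤ mΩ) (hI : MeasurableSpace.comap I ⊤ ≤ mΩ)
    (hind : Indep (MeasurableSpace.comap I ⊤) m P) (hφ : ∀ i, Measurable[m] (φ i))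
    (hφi : ∀ i, Integrable (φ i) P) :
    ∫ ω, φ (I ω) ω ∂P = ∑ i, P.real (I ⁻¹' {i}) * ∫ ω, φ i ω ∂P := by
  have hT : ∀ i, MeasurableSet[MeasurableSpace.comap I ⊤] (I ⁻¹' {i}) :=
    fun i => ⟨{i}, trivial, rfl⟩
  rw [comp_draw_eq_sum_indicator, integral_finsetSum _
    fun i _ => (hφi i).indicator (hI _ (hT i))]
  refine Finset.sum_congr rfl fun i _ => ?_
  rw [integral_indicator (hI _ (hT i))]
  exact setIntegral_eq_mul_of_indep hm hI hind (hT i) (hφ i) (hφi i)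

end Draw

lemma memLp_two_of_lintegral_le {E : Type*} [NormedAddCommGroup E]
    [MeasurableSpace E] [BorelSpace E] [SecondCountableTopology E] {ζ : Ω → E}
    (hζ : Measurable ζ) {σ : ℝ} (h : ∫⁻ ω, ‖ζ ω‖ₑ ^ 2 ∂P ≤ ENNReal.ofReal (σ ^ 2)) :
    MemLp ζ 2 P ∧ ∫ ω, ‖ζ ω‖ ^ 2 ∂P ≤ σ ^ 2 := by
  have h0 : ∫⁻ ω, ‖ζ ω‖ₑ ^ 2 ∂P < ∞ := h.trans_lt ENNReal.ofReal_lt_top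
  have hmem : MemLp ζ 2 P := by
    refine ⟨hζ.aestronglyMeasurable, ?_⟩
    rw [eLpNorm_lt_top_iff_lintegral_rpow_enorm_lt_top two_ne_zero ENNReal.ofNat_ne_top]
    simpa using h0
  refine ⟨hmem, ?_⟩
  rw [integral_eq_lintegral_of_nonneg_ae (ae_of_all _ fun _ => by positivity)
    (hmem.integrable_norm_pow two_ne_zero).aestronglyMeasurable]
  refine ENNReal.toReal_le_of_le_ofReal (sq_nonneg _) (le_trans (le_of_eq ?_) h)
  refine lintegral_congr fun ω => ?_
  rw [ENNReal.ofReal_pow (norm_nonneg _), ofReal_norm]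

lemma integrable_inner_of_memLp {E : Type*} [NormedAddCommGroup E] [InnerProductSpace ℝ E]
    {Y ζ : Ω → E} (hY : MemLp Y 2 P) (hζ : MemLp ζ 2 P) :
    Integrable (fun ω => ⟪Y ω, ζ ω⟫) P := by
  refine ((hY.integrable_norm_pow two_ne_zero).add (hζ.integrable_norm_pow two_ne_zero)).mono'
    (hY.1.inner hζ.1) (ae_of_all _ fun ω => ?_)
  refine (norm_inner_le_norm (𝕜 := ℝ) _ _).trans ?_
  simp only [Pi.add_apply]
  nlinarith [sq_nonneg (‖Y ω‖ - ‖ζ ω‖), sq_nonneg ‖Y ω‖, sq_nonneg ‖ζ ω‖]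

variable {E : Type*} [NormedAddCommGroup E] [InnerProductSpace ℝ E] [CompleteSpace E]
  [MeasurableSpace E] [BorelSpace E] [SecondCountableTopology E] [IsProbabilityMeasure P]

/-- A perturbation with zero conditional mean is orthogonal to everything known before. -/
lemma integral_inner_eq_zero {m : MeasurableSpace Ω} (hm : m ≤ mΩ) {Y ζ : Ω → E}
    (hY : Measurable[m] Y) (hY2 : MemLp Y 2 P) (hζ2 : MemLp ζ 2 P) (hζ : P[ζ | m] =ᵐ[P] 0) :
    ∫ ω, ⟪Y ω, ζ ω⟫ ∂P = 0 := by
  have h := condExp_bilin_of_stronglyMeasurable_left (innerSL ℝ) (μ := P) (m := m)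
    hY.stronglyMeasurable (integrable_inner_of_memLp hY2 hζ2) (hζ2.integrable one_le_two)
  have h2 : P[fun ω => ⟪Y ω, ζ ω⟫ | m] =ᵐ[P] 0 := by
    filter_upwards [h, hζ] with ω h1 h2
    refine h1.trans ?_
    rw [h2]
    simp
  rw [← integral_condExp hm, integral_congr_ae h2]
  simp

/-- Pythagoras for a centred perturbation. -/
lemma integral_norm_add_sq {m : MeasurableSpace Ω} (hm : m ≤ mΩ) {Y ζ : Ω → E}
    (hY : Measurable[m] Y) (hY2 : MemLp Y 2 P) (hζ2 : MemLp ζ 2 P) (hζ : P[ζ | m] =ᵐ[P] 0) :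
    ∫ ω, ‖Y ω + ζ ω‖ ^ 2 ∂P = ∫ ω, ‖Y ω‖ ^ 2 ∂P + ∫ ω, ‖ζ ω‖ ^ 2 ∂P := by
  have h := integral_inner_eq_zero hm hY hY2 hζ2 hζ
  have hi : Integrable (fun ω => ⟪Y ω, ζ ω⟫) P := integrable_inner_of_memLp hY2 hζ2
  have hYi : Integrable (fun ω => ‖Y ω‖ ^ 2) P := hY2.integrable_norm_pow two_ne_zero
  have hζi : Integrable (fun ω => ‖ζ ω‖ ^ 2) P := hζ2.integrable_norm_pow two_ne_zero
  simp_rw [norm_add_sq_real]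
  have h2 : Integrable (fun ω => ‖Y ω‖ ^ 2 + 2 * ⟪Y ω, ζ ω⟫) P := hYi.add (hi.const_mul 2)
  rw [integral_add h2 hζi, integral_add hYi (hi.const_mul 2), integral_const_mul, h]
  ring

end Probability

/-! ### The gradient estimator -/

section Estimator

open scoped RealInnerProductSpace

variable {p n : ℕ} {Ω : Type*} {mΩ : MeasurableSpace Ω} {P : Measure Ω}

/-- The situation in which the estimator is evaluated: a state `s` known at `m₀`, centred
perturbations `e` known at `me`, and an index `I` drawn from `q` independently of `me`. -/
structure IsSample (A : FiniteSumProblem p n) (σ : ℝ) {mΩ : MeasurableSpace Ω} (P : Measure Ω)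
    (m₀ me : MeasurableSpace Ω) (s : Ω → State p n) (e : Fin n → Ω → Vec p) (I : Ω → Fin n) :
    Prop where
  le_eval : m₀ ≤ me
  eval_le : me ≤ mΩ
  meas_x : Measurable[m₀] fun ω => (s ω).x
  meas_z : ∀ i, Measurable[m₀] fun ω => (s ω).z i
  memLp_x : MemLp (fun ω => (s ω).x) 2 P
  memLp_z : ∀ i, MemLp (fun ω => (s ω).z i) 2 P
  meas_e : ∀ i, Measurable[me] (e i)
  memLp_e : ∀ i, MemLp (e i) 2 P
  var_e : ∀ i, ∫ ω, ‖e i ω‖ ^ 2 ∂P ≤ σ ^ 2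
  mean_e : ∀ i, P[e i | m₀] =ᵐ[P] 0
  meas_I : Measurable[mΩ] I
  law_I : ∀ i, P.real (I ⁻¹' {i}) = A.q i
  indep_I : Indep (MeasurableSpace.comap I ⊤) me P

lemma memLp_comp_lipschitz {E F : Type*} [NormedAddCommGroup E] [NormedAddCommGroup F]
    [IsFiniteMeasure P] {K : NNReal} {g : E → F} (hg : LipschitzWith K g) {X : Ω → E}
    (hX : MemLp X 2 P) : MemLp (fun ω => g (X ω)) 2 P := by
  have h : LipschitzWith K (fun x => g x - g 0) := by
    refine LipschitzWith.of_dist_le_mul fun x y => ?_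
    rw [dist_sub_right]
    exact hg.dist_le_mul x y
  have h1 : MemLp (fun ω => g (X ω) - g 0) 2 P := h.comp_memLp (by simp) hX
  exact (memLp_congr_ae (ae_of_all _ fun ω => by simp)).1 (h1.add (memLp_const (g 0)))

namespace FiniteSumProblem

variable (A : FiniteSumProblem p n)

/-- The error of the estimator at index `i`, apart from the perturbation of the new gradient. -/
noncomputable def samplingError (s : State p n) (i : Fin n) : Vec p :=
  (1 / (A.q i * n)) • (gradient (A.f i) s.x - s.z i) + (1 / (n : ℝ)) • ∑ j, s.z j - A.gradAvg s.x

lemma gradEstimator_sub_gradAvg (s : State p n) (i : Fin n) (v : Vec p) :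
    gradEstimator A s i v - A.gradAvg s.x
      = A.samplingError s i + (1 / (A.q i * n)) • v := by
  unfold gradEstimator samplingError
  module

lemma sum_q_smul_samplingError (s : State p n) :
    ∑ i, A.q i • A.samplingError s i = 0 := by
  have h : ∀ i, A.q i • A.samplingError s i = (1 / (n : ℝ)) • (gradient (A.f i) s.x - s.z i)
      + A.q i • ((1 / (n : ℝ)) • ∑ j, s.z j - A.gradAvg s.x) := by
    intro i
    have hq := (A.q_pos i).ne'
    have hn := A.cast_n_pos.ne'
    have e : A.q i * (1 / (A.q i * n)) = 1 / (n : ℝ) := by field_simp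
    unfold samplingError
    rw [add_sub_assoc, smul_add, smul_smul, e]
  simp_rw [h]
  rw [Finset.sum_add_distrib, ← Finset.smul_sum, Finset.sum_sub_distrib, ← Finset.sum_smul,
    A.q_sum, gradAvg]
  module

/-- The variance of importance sampling is at most the second moment, and the latter splits into
the suboptimality of the current point and the quality of the table. -/
lemma sum_q_mul_sq_samplingError_le (s : State p n) (hx : A.ψ s.x ≠ ⊤) :
    ∑ i, A.q i * ‖A.samplingError s i‖ ^ 2
      ≤ 4 * A.LQ * A.subopt s.x + 2 * A.tableDist s.z := by
  have hn := A.cast_n_pos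
  set c : Vec p := (1 / (n : ℝ)) • ∑ j, s.z j - A.gradAvg s.x with hc
  set b : Fin n → Vec p := fun i => (1 / (A.q i * n)) • (gradient (A.f i) s.x - s.z i) with hb
  have e : ∀ i, A.samplingError s i = b i + c := fun i => by
    rw [samplingError, hb, hc, add_sub_assoc]
  have hsum : ∑ i, A.q i • b i = -c := by
    have h := A.sum_q_smul_samplingError s
    simp_rw [e, smul_add] at h
    rw [Finset.sum_add_distrib, ← Finset.sum_smul, A.q_sum, one_smul] at h
    exact eq_neg_of_add_eq_zero_left h
  have hvar : ∑ i, A.q i * ‖A.samplingError s i‖ ^ 2 = ∑ i, A.q i * ‖b i‖ ^ 2 - ‖c‖ ^ 2 := by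
    have h1 : ∀ i, A.q i * ‖A.samplingError s i‖ ^ 2
        = A.q i * ‖b i‖ ^ 2 + 2 * ⟪A.q i • b i, c⟫ + A.q i * ‖c‖ ^ 2 := by
      intro i
      rw [e, norm_add_sq_real, real_inner_smul_left (b i)]; ring
    simp_rw [h1]
    rw [Finset.sum_add_distrib, Finset.sum_add_distrib, ← Finset.mul_sum, ← sum_inner, hsum,
      inner_neg_left, real_inner_self_eq_norm_sq, ← Finset.sum_mul, A.q_sum]
    ring
  have hb2 : ∀ i, A.q i * ‖b i‖ ^ 2 ≤ 1 / (n : ℝ) * (1 / (A.q i * n) *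
      (2 * ‖gradient (A.f i) s.x - gradient (A.f i) A.xstar‖ ^ 2
        + 2 * ‖s.z i - gradient (A.f i) A.xstar‖ ^ 2)) := by
    intro i
    have hq := A.q_pos i
    have h1 : A.q i * ‖b i‖ ^ 2
        = 1 / (n : ℝ) * (1 / (A.q i * n) * ‖gradient (A.f i) s.x - s.z i‖ ^ 2) := by
      rw [hb, norm_smul, Real.norm_of_nonneg (by positivity)]
      field_simp
    rw [h1]
    gcongr
    have h2 : gradient (A.f i) s.x - s.z i = (gradient (A.f i) s.x - gradient (A.f i) A.xstar)
        - (s.z i - gradient (A.f i) A.xstar) := by abel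
    rw [h2]
    have h3 := parallelogram_law_with_norm ℝ (gradient (A.f i) s.x - gradient (A.f i) A.xstar)
        (s.z i - gradient (A.f i) A.xstar)
    nlinarith [mul_self_nonneg ‖gradient (A.f i) s.x - gradient (A.f i) A.xstar
        + (s.z i - gradient (A.f i) A.xstar)‖]
  have h4 : ∑ i, 1 / (n : ℝ) * (1 / (A.q i * n) *
      (2 * ‖gradient (A.f i) s.x - gradient (A.f i) A.xstar‖ ^ 2
        + 2 * ‖s.z i - gradient (A.f i) A.xstar‖ ^ 2))
      = 2 * A.tableDist (fun i => gradient (A.f i) s.x) + 2 * A.tableDist s.z := by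
    unfold tableDist
    simp_rw [Finset.mul_sum]
    rw [← Finset.sum_add_distrib]
    refine Finset.sum_congr rfl fun i _ => by ring
  have h5 := Finset.sum_le_sum fun i (_ : i ∈ Finset.univ) => hb2 i
  have h6 := A.tableDist_gradient_le hx
  have h7 : 0 ≤ ‖c‖ ^ 2 := by positivity
  linarith

lemma sum_q_mul_sq_le_rhoQ : ∑ i, A.q i * (1 / (A.q i * n)) ^ 2 ≤ A.rhoQ := by
  have hn := A.cast_n_pos
  have h : ∀ i ∈ Finset.univ, A.q i * (1 / (A.q i * n)) ^ 2 ≤ 1 / (n : ℝ) * A.rhoQ := by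
    intro i _
    have hq := A.q_pos i
    have : A.q i * (1 / (A.q i * n)) ^ 2 = 1 / (n : ℝ) * (1 / (A.q i * n)) := by field_simp
    rw [this]
    gcongr
    exact A.rhoQ_pos_and_le.2 i
  refine (Finset.sum_le_sum h).trans (le_of_eq ?_)
  rw [Finset.sum_const, Finset.card_univ, Fintype.card_fin, nsmul_eq_mul]
  field_simp

lemma lipschitzWith_gradAvg : LipschitzWith A.LQ.toNNReal A.gradAvg :=
  LipschitzWith.of_dist_le_mul fun x y => by
    rw [dist_eq_norm, dist_eq_norm, Real.coe_toNNReal _ A.LQ_pos.le, ← gradient_smoothPart,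
      ← gradient_smoothPart]
    exact A.norm_gradient_smoothPart_sub_le x y

lemma integrable_tableDist [IsProbabilityMeasure P] {z : Fin n → Ω → Vec p}
    (hz : ∀ i, MemLp (z i) 2 P) : Integrable (fun ω => A.tableDist fun i => z i ω) P := by
  unfold tableDist
  refine (integrable_finsetSum _ fun i _ => Integrable.const_mul ?_ _).const_mul _
  exact ((hz i).sub (memLp_const _)).integrable_norm_pow two_ne_zero

end FiniteSumProblem

namespace IsSample

variable {A : FiniteSumProblem p n} {σ : ℝ} {m₀ me : MeasurableSpace Ω} {s : Ω → State p n}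
  {e : Fin n → Ω → Vec p} {I : Ω → Fin n}

lemma m₀_le (h : IsSample A σ P m₀ me s e I) : m₀ ≤ mΩ := h.le_eval.trans h.eval_le

lemma measurable_samplingError (h : IsSample A σ P m₀ me s e I) (i : Fin n) :
    Measurable[m₀] fun ω => A.samplingError (s ω) i := by
  have h1 : Measurable[m₀] fun ω => gradient (A.f i) (s ω).x :=
    (A.lipschitzWith_gradient i).continuous.measurable.comp h.meas_x
  have h2 : Measurable[m₀] fun ω => A.gradAvg (s ω).x :=
    A.lipschitzWith_gradAvg.continuous.measurable.comp h.meas_x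
  have h3 := h.meas_z
  unfold FiniteSumProblem.samplingError
  fun_prop

lemma memLp_samplingError [IsProbabilityMeasure P] (h : IsSample A σ P m₀ me s e I) (i : Fin n) :
    MemLp (fun ω => A.samplingError (s ω) i) 2 P := by
  have h1 : MemLp (fun ω => (1 / (A.q i * n)) • (gradient (A.f i) (s ω).x - (s ω).z i)) 2 P :=
    ((memLp_comp_lipschitz (A.lipschitzWith_gradient i) h.memLp_x).sub (h.memLp_z i)).const_smul
      (1 / (A.q i * n))
  have h2 : MemLp (fun ω => (1 / (n : ℝ)) • ∑ j, (s ω).z j) 2 P :=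
    (memLp_finsetSum Finset.univ fun j _ => h.memLp_z j).const_smul (1 / (n : ℝ))
  exact (h1.add h2).sub (memLp_comp_lipschitz A.lipschitzWith_gradAvg h.memLp_x)

lemma measurable_error (h : IsSample A σ P m₀ me s e I) (i : Fin n) :
    Measurable[me] fun ω => gradEstimator A (s ω) i (e i ω) - A.gradAvg (s ω).x := by
  simp_rw [A.gradEstimator_sub_gradAvg]
  exact ((h.measurable_samplingError i).mono h.le_eval le_rfl).add
    ((h.meas_e i).const_smul (1 / (A.q i * n)))

lemma memLp_error [IsProbabilityMeasure P] (h : IsSample A σ P m₀ me s e I) (i : Fin n) :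
    MemLp (fun ω => gradEstimator A (s ω) i (e i ω) - A.gradAvg (s ω).x) 2 P := by
  simp_rw [A.gradEstimator_sub_gradAvg]
  exact (h.memLp_samplingError i).add ((h.memLp_e i).const_smul (1 / (A.q i * n)))

lemma comap_le (h : IsSample A σ P m₀ me s e I) : MeasurableSpace.comap I ⊤ ≤ mΩ :=
  h.meas_I.comap_le

lemma memLp_error_draw [IsProbabilityMeasure P] (h : IsSample A σ P m₀ me s e I) :
    MemLp (fun ω => gradEstimator A (s ω) (I ω) (e (I ω) ω) - A.gradAvg (s ω).x) 2 P :=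
  memLp_comp_draw (φ := fun i ω => gradEstimator A (s ω) i (e i ω) - A.gradAvg (s ω).x)
    (fun i => h.meas_I (measurableSet_singleton i)) (fun i => h.memLp_error i)

lemma memLp_estimator [IsProbabilityMeasure P] (h : IsSample A σ P m₀ me s e I) :
    MemLp (fun ω => gradEstimator A (s ω) (I ω) (e (I ω) ω)) 2 P :=
  (memLp_congr_ae (ae_of_all _ fun ω => by simp)).1
    (h.memLp_error_draw.add (memLp_comp_lipschitz A.lipschitzWith_gradAvg h.memLp_x))

/-- The estimator is unbiased. -/
lemma integral_inner_error [IsProbabilityMeasure P] (h : IsSample A σ P m₀ me s e I)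
    {Y : Ω → Vec p} (hY : Measurable[m₀] Y) (hY2 : MemLp Y 2 P) :
    ∫ ω, ⟪Y ω, gradEstimator A (s ω) (I ω) (e (I ω) ω) - A.gradAvg (s ω).x⟫ ∂P = 0 := by
  rw [integral_comp_draw
    (φ := fun i ω => ⟪Y ω, gradEstimator A (s ω) i (e i ω) - A.gradAvg (s ω).x⟫)
    h.eval_le h.comap_le h.indep_I
    (fun i => Measurable.inner (hY.mono h.le_eval le_rfl) (h.measurable_error i))
    (fun i => integrable_inner_of_memLp hY2 (h.memLp_error i))]
  have hi : ∀ i, ∫ ω, ⟪Y ω, gradEstimator A (s ω) i (e i ω) - A.gradAvg (s ω).x⟫ ∂P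
      = ∫ ω, ⟪Y ω, A.samplingError (s ω) i⟫ ∂P := by
    intro i
    simp_rw [A.gradEstimator_sub_gradAvg, inner_add_right, inner_smul_right]
    rw [integral_add (integrable_inner_of_memLp hY2 (h.memLp_samplingError i))
      ((integrable_inner_of_memLp hY2 (h.memLp_e i)).const_mul _), integral_const_mul,
      integral_inner_eq_zero h.m₀_le hY hY2 (h.memLp_e i) (h.mean_e i), mul_zero, add_zero]
  simp_rw [hi, h.law_I, ← integral_const_mul]
  rw [← integral_finsetSum _ fun i _ =>
    (integrable_inner_of_memLp hY2 (h.memLp_samplingError i)).const_mul _]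
  simp_rw [← inner_smul_right, ← inner_sum, A.sum_q_smul_samplingError, inner_zero_right]
  simp

/-- The variance of the estimator: it vanishes with the suboptimality and the quality of the
table, up to the perturbations. -/
lemma integral_sq_error_le [IsProbabilityMeasure P] (h : IsSample A σ P m₀ me s e I)
    (hdom : ∀ ω, A.ψ (s ω).x ≠ ⊤) (hint : Integrable (fun ω => A.subopt (s ω).x) P) :
    ∫ ω, ‖gradEstimator A (s ω) (I ω) (e (I ω) ω) - A.gradAvg (s ω).x‖ ^ 2 ∂P
      ≤ A.rhoQ * σ ^ 2 + 4 * A.LQ * ∫ ω, A.subopt (s ω).x ∂P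
        + 2 * ∫ ω, A.tableDist (s ω).z ∂P := by
  rw [integral_comp_draw
    (φ := fun i ω => ‖gradEstimator A (s ω) i (e i ω) - A.gradAvg (s ω).x‖ ^ 2)
    h.eval_le h.comap_le h.indep_I
    (fun i => (h.measurable_error i).norm.pow_const 2)
    (fun i => (h.memLp_error i).integrable_norm_pow two_ne_zero)]
  have hi : ∀ i, ∫ ω, ‖gradEstimator A (s ω) i (e i ω) - A.gradAvg (s ω).x‖ ^ 2 ∂P
      ≤ ∫ ω, ‖A.samplingError (s ω) i‖ ^ 2 ∂P + (1 / (A.q i * n)) ^ 2 * σ ^ 2 := by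
    intro i
    simp_rw [A.gradEstimator_sub_gradAvg]
    have hmean : P[(1 / (A.q i * n)) • e i | m₀] =ᵐ[P] 0 := by
      filter_upwards [condExp_smul (1 / (A.q i * n)) (e i) m₀ (μ := P), h.mean_e i] with ω h1 h2
      rw [h1, Pi.smul_apply, h2]; simp
    have h1 := integral_norm_add_sq h.m₀_le (h.measurable_samplingError i)
      (h.memLp_samplingError i) ((h.memLp_e i).const_smul (1 / (A.q i * n))) hmean
    simp only [Pi.smul_apply] at h1
    rw [h1]
    simp_rw [norm_smul, mul_pow]
    rw [integral_const_mul, Real.norm_eq_abs, sq_abs]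
    gcongr
    exact h.var_e i
  have hsq : ∀ i, Integrable (fun ω => ‖A.samplingError (s ω) i‖ ^ 2) P :=
    fun i => (h.memLp_samplingError i).integrable_norm_pow two_ne_zero
  calc ∑ i, P.real (I ⁻¹' {i}) *
        ∫ ω, ‖gradEstimator A (s ω) i (e i ω) - A.gradAvg (s ω).x‖ ^ 2 ∂P
      ≤ ∑ i, A.q i * (∫ ω, ‖A.samplingError (s ω) i‖ ^ 2 ∂P
          + (1 / (A.q i * n)) ^ 2 * σ ^ 2) := by
        refine Finset.sum_le_sum fun i _ => ?_
        rw [h.law_I]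
        exact mul_le_mul_of_nonneg_left (hi i) (A.q_pos i).le
    _ = ∫ ω, ∑ i, A.q i * ‖A.samplingError (s ω) i‖ ^ 2 ∂P
          + (∑ i, A.q i * (1 / (A.q i * n)) ^ 2) * σ ^ 2 := by
        rw [integral_finsetSum _ fun i _ => (hsq i).const_mul _, Finset.sum_mul,
          ← Finset.sum_add_distrib]
        refine Finset.sum_congr rfl fun i _ => ?_
        rw [integral_const_mul]; ring
    _ ≤ ∫ ω, (4 * A.LQ * A.subopt (s ω).x + 2 * A.tableDist (s ω).z) ∂P
          + A.rhoQ * σ ^ 2 := by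
        refine add_le_add (integral_mono
          (integrable_finsetSum _ fun i _ => (hsq i).const_mul _)
          ((hint.const_mul _).add ((A.integrable_tableDist h.memLp_z).const_mul _))
          fun ω => A.sum_q_mul_sq_samplingError_le (s ω) (hdom ω))
          (mul_le_mul_of_nonneg_right A.sum_q_mul_sq_le_rhoQ (sq_nonneg σ))
    _ = _ := by
        rw [integral_add (hint.const_mul _) ((A.integrable_tableDist h.memLp_z).const_mul _),
          integral_const_mul, integral_const_mul]
        ring

end IsSample

end Estimator

/-! ### The table of stored gradients -/

section Table

open scoped RealInnerProductSpace

variable {p n : ℕ} {Ω : Type*} {mΩ : MeasurableSpace Ω} {P : Measure Ω}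

namespace FiniteSumProblem

variable (A : FiniteSumProblem p n)

lemma measurable_subopt : Measurable A.subopt :=
  (A.differentiable_smoothPart.continuous.measurable.add
    (A.ψ_lsc.measurable.ereal_toReal)).sub_const _

lemma sum_weights_le_rhoQ : (1 / (n : ℝ)) * ∑ i, 1 / (A.q i * n) ≤ A.rhoQ := by
  have hn := A.cast_n_pos
  refine le_trans (le_of_eq ?_) A.sum_q_mul_sq_le_rhoQ
  rw [Finset.mul_sum]
  refine Finset.sum_congr rfl fun i _ => ?_
  have hq := A.q_pos i
  field_simp

lemma integral_tableDist [IsProbabilityMeasure P] {z : Fin n → Ω → Vec p}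
    (hz : ∀ i, MemLp (z i) 2 P) : ∫ ω, A.tableDist (fun i => z i ω) ∂P =
      (1 / (n : ℝ)) * ∑ i, 1 / (A.q i * n) *
        ∫ ω, ‖z i ω - gradient (A.f i) A.xstar‖ ^ 2 ∂P := by
  have h : ∀ i, Integrable (fun ω => ‖z i ω - gradient (A.f i) A.xstar‖ ^ 2) P :=
    fun i => ((hz i).sub (memLp_const _)).integrable_norm_pow two_ne_zero
  unfold tableDist
  rw [integral_const_mul, integral_finsetSum _ fun i _ => (h i).const_mul _]
  simp_rw [integral_const_mul]

/-- A table all of whose entries are freshly perturbed gradients at `X`. -/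
lemma integral_tableDist_fresh_le [IsProbabilityMeasure P] {σ : ℝ} {m : MeasurableSpace Ω}
    (hm : m ≤ mΩ) {X : Ω → Vec p} (hX : Measurable[m] X) (hX2 : MemLp X 2 P)
    (hdom : ∀ ω, A.ψ (X ω) ≠ ⊤) (hint : Integrable (fun ω => A.subopt (X ω)) P)
    {ζ : Fin n → Ω → Vec p} (hζ2 : ∀ i, MemLp (ζ i) 2 P)
    (hζv : ∀ i, ∫ ω, ‖ζ i ω‖ ^ 2 ∂P ≤ σ ^ 2) (hζm : ∀ i, P[ζ i | m] =ᵐ[P] 0) :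
    ∫ ω, A.tableDist (fun i => gradient (A.f i) (X ω) + ζ i ω) ∂P ≤
      2 * A.LQ * ∫ ω, A.subopt (X ω) ∂P + A.rhoQ * σ ^ 2 := by
  have hn := A.cast_n_pos
  have hg2 : ∀ i, MemLp (fun ω => gradient (A.f i) (X ω)) 2 P :=
    fun i => memLp_comp_lipschitz (A.lipschitzWith_gradient i) hX2
  have h1 : ∀ i, ∫ ω, ‖gradient (A.f i) (X ω) + ζ i ω - gradient (A.f i) A.xstar‖ ^ 2 ∂P
      ≤ ∫ ω, ‖gradient (A.f i) (X ω) - gradient (A.f i) A.xstar‖ ^ 2 ∂P + σ ^ 2 := by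
    intro i
    have h := integral_norm_add_sq hm
      (((A.lipschitzWith_gradient i).continuous.measurable.comp hX).sub_const
        (gradient (A.f i) A.xstar))
      ((hg2 i).sub (memLp_const (gradient (A.f i) A.xstar))) (hζ2 i) (hζm i)
    have e : ∀ ω, gradient (A.f i) (X ω) + ζ i ω - gradient (A.f i) A.xstar
        = gradient (A.f i) (X ω) - gradient (A.f i) A.xstar + ζ i ω := fun ω => by abel
    simp_rw [e]
    exact h.trans_le (add_le_add le_rfl (hζv i))
  have hy2 : ∀ i, MemLp (fun ω => gradient (A.f i) (X ω) + ζ i ω) 2 P :=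
    fun i => (hg2 i).add (hζ2 i)
  rw [A.integral_tableDist hy2]
  calc _ ≤ (1 / (n : ℝ)) * ∑ i, 1 / (A.q i * n) *
        (∫ ω, ‖gradient (A.f i) (X ω) - gradient (A.f i) A.xstar‖ ^ 2 ∂P + σ ^ 2) := by
        refine mul_le_mul_of_nonneg_left (Finset.sum_le_sum fun i _ => ?_) (by positivity)
        exact mul_le_mul_of_nonneg_left (h1 i) (one_div_nonneg.2 (A.qn_pos i).le)
    _ = ∫ ω, A.tableDist (fun i => gradient (A.f i) (X ω)) ∂P
        + ((1 / (n : ℝ)) * ∑ i, 1 / (A.q i * n)) * σ ^ 2 := by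
        rw [A.integral_tableDist hg2]
        simp_rw [mul_add, Finset.sum_add_distrib, ← Finset.sum_mul]
        ring
    _ ≤ _ := by
        refine add_le_add ?_ (mul_le_mul_of_nonneg_right A.sum_weights_le_rhoQ (sq_nonneg σ))
        rw [← integral_const_mul]
        exact integral_mono (A.integrable_tableDist hg2) (hint.const_mul _)
          fun ω => A.tableDist_gradient_le (hdom ω)

/-- If each entry of the table is replaced with probability `1 / n`, independently of the old and
the new entries, the expected quality of the table is the corresponding mixture. -/
lemma integral_tableDist_refresh [IsProbabilityMeasure P] {m m' : MeasurableSpace Ω}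
    (hm : m ≤ mΩ) (hm' : m' ≤ mΩ) (hind : Indep m' m P) {R : Ω → Finset (Fin n)}
    (hR : ∀ j, MeasurableSet[m'] {ω | j ∈ R ω}) (hRP : ∀ j, P.real {ω | j ∈ R ω} = 1 / n)
    {y z : Fin n → Ω → Vec p} (hy : ∀ i, Measurable[m] (y i)) (hz : ∀ i, Measurable[m] (z i))
    (hy2 : ∀ i, MemLp (y i) 2 P) (hz2 : ∀ i, MemLp (z i) 2 P) :
    (∀ i, MemLp (fun ω => if i ∈ R ω then y i ω else z i ω) 2 P) ∧
    ∫ ω, A.tableDist (fun i => if i ∈ R ω then y i ω else z i ω) ∂P =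
      (1 - 1 / n) * ∫ ω, A.tableDist (fun i => z i ω) ∂P
        + 1 / n * ∫ ω, A.tableDist (fun i => y i ω) ∂P := by
  have hw2 : ∀ i, MemLp (fun ω => if i ∈ R ω then y i ω else z i ω) 2 P := by
    intro i
    have h := (hy2 i).indicator (hm' _ (hR i))
    have h' := (hz2 i).indicator (hm' _ (hR i)).compl
    refine (memLp_congr_ae (ae_of_all _ fun ω => ?_)).1 (h.add h')
    by_cases hi : i ∈ R ω <;> simp [hi]
  refine ⟨hw2, ?_⟩
  rw [A.integral_tableDist hw2, A.integral_tableDist hy2, A.integral_tableDist hz2]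
  have hmeas : ∀ i, Measurable fun v : Vec p => ‖v - gradient (A.f i) A.xstar‖ ^ 2 :=
    fun i => Continuous.measurable (by fun_prop)
  have key : ∀ i, ∫ ω, ‖(if i ∈ R ω then y i ω else z i ω) - gradient (A.f i) A.xstar‖ ^ 2 ∂P
      = (1 - 1 / n) * ∫ ω, ‖z i ω - gradient (A.f i) A.xstar‖ ^ 2 ∂P
        + 1 / n * ∫ ω, ‖y i ω - gradient (A.f i) A.xstar‖ ^ 2 ∂P := by
    intro i
    have hi := ((hw2 i).sub (memLp_const (gradient (A.f i) A.xstar))).integrable_norm_pow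
      two_ne_zero
    have hyi := ((hy2 i).sub (memLp_const (gradient (A.f i) A.xstar))).integrable_norm_pow
      two_ne_zero
    have hzi := ((hz2 i).sub (memLp_const (gradient (A.f i) A.xstar))).integrable_norm_pow
      two_ne_zero
    have hT := hm' _ (hR i)
    simp only [Pi.sub_apply] at hi hyi hzi
    rw [← integral_add_compl hT hi]
    have e1 : ∫ ω in {ω | i ∈ R ω},
        ‖(if i ∈ R ω then y i ω else z i ω) - gradient (A.f i) A.xstar‖ ^ 2 ∂P
        = ∫ ω in {ω | i ∈ R ω}, ‖y i ω - gradient (A.f i) A.xstar‖ ^ 2 ∂P :=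
      setIntegral_congr_fun hT fun ω hω => by
        have hω' : i ∈ R ω := hω
        simp [hω']
    have e2 : ∫ ω in {ω | i ∈ R ω}ᶜ,
        ‖(if i ∈ R ω then y i ω else z i ω) - gradient (A.f i) A.xstar‖ ^ 2 ∂P
        = ∫ ω in {ω | i ∈ R ω}ᶜ, ‖z i ω - gradient (A.f i) A.xstar‖ ^ 2 ∂P :=
      setIntegral_congr_fun hT.compl fun ω hω => by
        have hω' : i ∉ R ω := hω
        simp [hω']
    rw [e1, e2,
      setIntegral_eq_mul_of_indep (f := fun ω => ‖y i ω - gradient (A.f i) A.xstar‖ ^ 2) hm hm'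
        hind (hR i) ((hmeas i).comp (hy i)) hyi,
      setIntegral_eq_mul_of_indep (f := fun ω => ‖z i ω - gradient (A.f i) A.xstar‖ ^ 2) hm hm'
        hind (hR i).compl ((hmeas i).comp (hz i)) hzi,
      probReal_compl_eq_one_sub hT, hRP]
    ring
  simp_rw [key, Finset.mul_sum]
  rw [← Finset.sum_add_distrib]
  exact Finset.sum_congr rfl fun i _ => by ring

end FiniteSumProblem

end Table

/-! ### One iteration of the algorithm -/

section Run

open scoped RealInnerProductSpace

variable {p n : ℕ} {Ω : Type*}

/-- The information available when the gradient of iteration `k + 1` has been evaluated. -/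
@[reducible] def histEval (x0 : Ω → Vec p) (D : Draws p n Ω) (k : ℕ) : MeasurableSpace Ω :=
  history x0 D k ⊔ ⨆ i, MeasurableSpace.comap (D.evalNoise (k + 1) i) inferInstance

/-- The information available when `x_{k+1}` has been computed. -/
@[reducible] def histIdx (x0 : Ω → Vec p) (D : Draws p n Ω) (k : ℕ) : MeasurableSpace Ω :=
  histEval x0 D k ⊔ MeasurableSpace.comap (D.idx (k + 1)) ⊤

/-- The information available before the refreshed set of iteration `k + 1` is drawn. By definition,
`history x0 D (k + 1)` is its join with the σ-algebra generated by that set. -/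
@[reducible] def histTable (x0 : Ω → Vec p) (D : Draws p n Ω) (k : ℕ) : MeasurableSpace Ω :=
  histIdx x0 D k ⊔ ⨆ i, MeasurableSpace.comap (D.tableNoise (k + 1) i) inferInstance

/-- A run of the algorithm with step sizes at most `η`, from a starting point in the domain of `ψ`
whose expected suboptimality is finite. -/
structure IsRun (A : FiniteSumProblem p n) (m : Method) (σ : ℝ) {mΩ : MeasurableSpace Ω}
    (P : Measure Ω) (x0 : Ω → Vec p) (D : Draws p n Ω) (η : ℕ → ℝ) : Prop where
  admissible : Admissible A m σ P x0 D
  measurable_x0 : Measurable x0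
  mem_dom : ∀ ω, A.ψ (x0 ω) ≠ ⊤
  integrable : Integrable (fun ω => A.subopt (x0 ω)) P
  step_pos : ∀ k, 0 < η k
  step_le : ∀ k, η k ≤ A.eta

/-- Measurability and integrability of a state of the algorithm, with the iterates in the domain
of `ψ`. -/
structure IsRegular (A : FiniteSumProblem p n) {mΩ : MeasurableSpace Ω} (P : Measure Ω)
    (m : MeasurableSpace Ω) (s : Ω → State p n) : Prop where
  meas_x : Measurable[m] fun ω => (s ω).x
  meas_z : ∀ i, Measurable[m] fun ω => (s ω).z i
  meas_xhat : Measurable[m] fun ω => (s ω).xhat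
  dom_x : ∀ ω, A.ψ (s ω).x ≠ ⊤
  dom_xhat : ∀ ω, A.ψ (s ω).xhat ≠ ⊤
  memLp_x : MemLp (fun ω => (s ω).x) 2 P
  memLp_z : ∀ i, MemLp (fun ω => (s ω).z i) 2 P
  int_x : Integrable (fun ω => A.subopt (s ω).x) P
  int_xhat : Integrable (fun ω => A.subopt (s ω).xhat) P

variable {mΩ : MeasurableSpace Ω} {P : Measure Ω} {A : FiniteSumProblem p n} {m : Method} {σ : ℝ}
  {x0 : Ω → Vec p} {D : Draws p n Ω} {η : ℕ → ℝ}

lemma HasRefreshLaw.probReal_mem {S : Ω → Finset (Fin n)} (h : HasRefreshLaw P S m) (j : Fin n) :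
    P.real {ω | j ∈ S ω} = 1 / n := by
  have key : ∀ s : Set Ω, P s = (n : ℝ≥0∞)⁻¹ → P.real s = 1 / n := fun s hs => by
    simp [Measure.real, hs]
  cases m with
  | randomSVRG =>
    rw [← key _ h.2]
    congr 1
    ext ω
    rcases h.1 ω with h1 | h1
    · simp [h1]
    · have : (∅ : Finset (Fin n)) ≠ Finset.univ := fun h2 =>
        Finset.notMem_empty j (h2 ▸ Finset.mem_univ j)
      simp [h1, this]
  | saga =>
    rw [← key _ (h.2 j)]
    congr 1
    ext ω
    obtain ⟨i, hi⟩ := h.1 ω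
    simp [hi, eq_comm]

namespace Admissible

lemma refresh_comap_le (h : Admissible A m σ P x0 D) (k : ℕ) :
    MeasurableSpace.comap (D.refresh k) ⊤ ≤ mΩ := by
  rintro _ ⟨t, -, rfl⟩
  have : D.refresh k ⁻¹' t = ⋃ s ∈ t, {ω | D.refresh k ω = s} := by ext; simp
  rw [this]
  exact MeasurableSet.biUnion (Set.to_countable t) fun s _ => h.meas_refresh k s

lemma idx_comap_le (h : Admissible A m σ P x0 D) (k : ℕ) :
    MeasurableSpace.comap (D.idx k) ⊤ ≤ mΩ := (h.meas_idx k).comap_le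

lemma history_le (h : Admissible A m σ P x0 D) (hx0 : Measurable x0) (k : ℕ) :
    history x0 D k ≤ mΩ := by
  induction k with
  | zero => exact sup_le hx0.comap_le (iSup_le fun i => (h.meas_tableNoise 0 i).comap_le)
  | succ k ih =>
    exact sup_le (sup_le (sup_le (sup_le ih
      (iSup_le fun i => (h.meas_evalNoise (k + 1) i).comap_le)) (h.idx_comap_le _))
      (iSup_le fun i => (h.meas_tableNoise (k + 1) i).comap_le)) (h.refresh_comap_le _)

lemma histTable_le (h : Admissible A m σ P x0 D) (hx0 : Measurable x0) (k : ℕ) :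
    histTable x0 D k ≤ mΩ := le_sup_left.trans (h.history_le hx0 (k + 1))

end Admissible

lemma measurable_evalNoise (x0 : Ω → Vec p) (D : Draws p n Ω) (k : ℕ) (i : Fin n) :
    Measurable[histEval x0 D k] (D.evalNoise (k + 1) i) :=
  measurable_iff_comap_le.2 ((le_iSup (fun i =>
    MeasurableSpace.comap (D.evalNoise (k + 1) i) inferInstance) i).trans le_sup_right)

lemma measurable_tableNoise (x0 : Ω → Vec p) (D : Draws p n Ω) (k : ℕ) (i : Fin n) :
    Measurable[histTable x0 D k] (D.tableNoise (k + 1) i) :=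
  measurable_iff_comap_le.2 ((le_iSup (fun i =>
    MeasurableSpace.comap (D.tableNoise (k + 1) i) inferInstance) i).trans le_sup_right)

lemma measurable_tableNoise_zero (x0 : Ω → Vec p) (D : Draws p n Ω) (i : Fin n) :
    Measurable[history x0 D 0] (D.tableNoise 0 i) :=
  measurable_iff_comap_le.2 ((le_iSup (fun i =>
    MeasurableSpace.comap (D.tableNoise 0 i) inferInstance) i).trans le_sup_right)

lemma measurable_gradient_comp {m' : MeasurableSpace Ω} {X : Ω → Vec p} (hX : Measurable[m'] X)
    (A : FiniteSumProblem p n) (i : Fin n) : Measurable[m'] fun ω => gradient (A.f i) (X ω) :=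
  (A.lipschitzWith_gradient i).continuous.measurable.comp hX

lemma measurable_comp_draw {ι : Type*} [Fintype ι] {m : MeasurableSpace Ω} {I : Ω → ι}
    (hI : ∀ i, MeasurableSet[m] (I ⁻¹' {i})) {φ : ι → Ω → Vec p} (hφ : ∀ i, Measurable[m] (φ i)) :
    Measurable[m] fun ω => φ (I ω) ω := by
  rw [comp_draw_eq_sum_indicator]
  exact Finset.measurable_fun_sum _ fun i _ => (hφ i).indicator (hI i)

namespace IsRun

lemma tau_eq (h : IsRun A m σ P x0 D η) (k : ℕ) :
    min (A.μ * η k) (1 / (5 * (n : ℝ))) = A.μ * η k := by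
  have hn := A.cast_n_pos
  refine min_eq_left ?_
  rw [le_div_iff₀ (by positivity)]
  have h1 := A.mu_mul_eta_mul_n_le
  have h2 := mul_le_mul_of_nonneg_left (h.step_le k) A.μ_pos.le
  nlinarith

lemma tau_nonneg (h : IsRun A m σ P x0 D η) (k : ℕ) : 0 ≤ A.μ * η k :=
  (mul_pos A.μ_pos (h.step_pos k)).le

lemma tau_le (h : IsRun A m σ P x0 D η) (k : ℕ) : A.μ * η k ≤ 1 / (5 * n) := by
  rw [← h.tau_eq k]; exact min_le_right _ _

lemma tau_le_one (h : IsRun A m σ P x0 D η) (k : ℕ) : A.μ * η k ≤ 1 := by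
  have hn : (1 : ℝ) ≤ n := by exact_mod_cast A.n_pos
  refine (h.tau_le k).trans ?_
  rw [div_le_one (by positivity)]; linarith

lemma step_mul_LQ_le (h : IsRun A m σ P x0 D η) (k : ℕ) : η k * A.LQ ≤ 1 / 12 :=
  (mul_le_mul_of_nonneg_right (h.step_le k) A.LQ_pos.le).trans A.eta_mul_LQ_le

lemma isSample (h : IsRun A m σ P x0 D η) {k : ℕ}
    (hs : IsRegular A P (history x0 D k) (run A η x0 D k)) :
    IsSample A σ P (history x0 D k) (histEval x0 D k) (run A η x0 D k)
      (D.evalNoise (k + 1)) (D.idx (k + 1)) where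
  le_eval := le_sup_left
  eval_le := (le_sup_left.trans le_sup_left).trans (h.admissible.histTable_le h.measurable_x0 k)
  meas_x := hs.meas_x
  meas_z := hs.meas_z
  memLp_x := hs.memLp_x
  memLp_z := hs.memLp_z
  meas_e := measurable_evalNoise x0 D k
  memLp_e i := (memLp_two_of_lintegral_le (h.admissible.meas_evalNoise (k + 1) i)
    (h.admissible.eval_var k i)).1
  var_e i := (memLp_two_of_lintegral_le (h.admissible.meas_evalNoise (k + 1) i)
    (h.admissible.eval_var k i)).2
  mean_e := h.admissible.eval_mean k
  meas_I := h.admissible.meas_idx (k + 1)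
  law_I i := by
    have := h.admissible.idx_law k i
    rw [Measure.real, Set.preimage]
    simp only [Set.mem_singleton_iff]
    rw [this, ENNReal.toReal_ofReal (A.q_pos i).le]
  indep_I := h.admissible.idx_indep k

lemma memLp_tableNoise (h : IsRun A m σ P x0 D η) (k : ℕ) (i : Fin n) :
    MemLp (D.tableNoise k i) 2 P :=
  (memLp_two_of_lintegral_le (h.admissible.meas_tableNoise k i) (h.admissible.table_var k i)).1

lemma integral_tableNoise_le (h : IsRun A m σ P x0 D η) (k : ℕ) (i : Fin n) :
    ∫ ω, ‖D.tableNoise k i ω‖ ^ 2 ∂P ≤ σ ^ 2 :=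
  (memLp_two_of_lintegral_le (h.admissible.meas_tableNoise k i) (h.admissible.table_var k i)).2

/-- The gradient estimate `g_{k+1}`. -/
noncomputable abbrev estimate (A : FiniteSumProblem p n) (η : ℕ → ℝ) (x0 : Ω → Vec p)
    (D : Draws p n Ω) (k : ℕ) (ω : Ω) : Vec p :=
  gradEstimator A (run A η x0 D k ω) (D.idx (k + 1) ω)
    (D.evalNoise (k + 1) (D.idx (k + 1) ω) ω)

lemma run_succ_xhat (h : IsRun A m σ P x0 D η) (k : ℕ) (ω : Ω) : (run A η x0 D (k + 1) ω).xhat =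
    (1 - A.μ * η (k + 1)) • (run A η x0 D k ω).xhat
      + (A.μ * η (k + 1)) • (run A η x0 D (k + 1) ω).x := by
  rw [← h.tau_eq (k + 1)]; rfl

lemma run_succ_z (k : ℕ) (ω : Ω) (j : Fin n) : (run A η x0 D (k + 1) ω).z j =
    if j ∈ D.refresh (k + 1) ω then
      gradient (A.f j) (run A η x0 D (k + 1) ω).x + D.tableNoise (k + 1) j ω
    else (run A η x0 D k ω).z j := rfl

lemma measurable_succ_x (h : IsRun A m σ P x0 D η) {k : ℕ}
    (hs : IsRegular A P (history x0 D k) (run A η x0 D k)) :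
    Measurable[histIdx x0 D k] fun ω => (run A η x0 D (k + 1) ω).x := by
  have h0 : history x0 D k ≤ histIdx x0 D k := le_sup_left.trans le_sup_left
  have hx := hs.meas_x.mono h0 le_rfl
  have hz := fun i => (hs.meas_z i).mono h0 le_rfl
  have he := fun i => (measurable_evalNoise x0 D k i).mono
    (le_sup_left : histEval x0 D k ≤ histIdx x0 D k) le_rfl
  have hg : Measurable[histIdx x0 D k] fun ω => estimate A η x0 D k ω := by
    refine measurable_comp_draw
      (φ := fun i ω => gradEstimator A (run A η x0 D k ω) i (D.evalNoise (k + 1) i ω))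
      (fun i => ?_) (fun i => ?_)
    · exact (le_sup_right : _ ≤ histIdx x0 D k) _ ⟨{i}, trivial, rfl⟩
    · have hgr := measurable_gradient_comp hx A i
      unfold gradEstimator
      fun_prop
  exact (A.lipschitzWith_prox (h.step_pos (k + 1))).continuous.measurable.comp
    (hx.sub (hg.const_smul (η (k + 1))))

variable [IsProbabilityMeasure P]

lemma memLp_x0 (h : IsRun A m σ P x0 D η) : MemLp x0 2 P := by
  have hμ := A.μ_pos
  have h1 : MemLp (fun ω => x0 ω - A.xstar) 2 P := by
    rw [memLp_two_iff_integrable_sq_norm (h.measurable_x0.sub_const _).aestronglyMeasurable]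
    refine (h.integrable.const_mul (2 / A.μ)).mono'
      ((h.measurable_x0.sub_const _).norm.pow_const 2).aestronglyMeasurable
      (ae_of_all _ fun ω => ?_)
    rw [Real.norm_of_nonneg (by positivity)]
    have := A.sq_dist_xstar_le (h.mem_dom ω)
    calc ‖x0 ω - A.xstar‖ ^ 2 = 2 / A.μ * (A.μ / 2 * ‖x0 ω - A.xstar‖ ^ 2) := by field_simp
      _ ≤ _ := by gcongr
  exact (memLp_congr_ae (ae_of_all _ fun ω => by simp)).1 (h1.add (memLp_const A.xstar))

lemma isRegular_zero (h : IsRun A m σ P x0 D η) :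
    IsRegular A P (history x0 D 0) (run A η x0 D 0) := by
  have hx : Measurable[history x0 D 0] x0 := measurable_iff_comap_le.2 le_sup_left
  exact
  { meas_x := hx
    meas_z := fun i => (measurable_gradient_comp hx A i).add (measurable_tableNoise_zero x0 D i)
    meas_xhat := hx
    dom_x := h.mem_dom
    dom_xhat := h.mem_dom
    memLp_x := h.memLp_x0
    memLp_z := fun i => (memLp_comp_lipschitz (A.lipschitzWith_gradient i) h.memLp_x0).add
      (h.memLp_tableNoise 0 i)
    int_x := h.integrable
    int_xhat := h.integrable }

lemma memLp_succ_x (h : IsRun A m σ P x0 D η) {k : ℕ}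
    (hs : IsRegular A P (history x0 D k) (run A η x0 D k)) :
    MemLp (fun ω => (run A η x0 D (k + 1) ω).x) 2 P :=
  memLp_comp_lipschitz (A.lipschitzWith_prox (h.step_pos (k + 1)))
    (hs.memLp_x.sub ((h.isSample hs).memLp_estimator.const_smul (η (k + 1))))

/-- The noiseless proximal step, relative to the minimizer. -/
lemma noiseless_step (h : IsRun A m σ P x0 D η) {k : ℕ}
    (hs : IsRegular A P (history x0 D k) (run A η x0 D k)) :
    let Y := fun ω => A.xstar - prox (η (k + 1)) A.ψ
      ((run A η x0 D k ω).x - η (k + 1) • A.gradAvg (run A η x0 D k ω).x)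
    Measurable[history x0 D k] Y ∧ MemLp Y 2 P := by
  have hp := A.lipschitzWith_prox (h.step_pos (k + 1))
  have hg : Measurable[history x0 D k] fun ω => A.gradAvg (run A η x0 D k ω).x :=
    A.lipschitzWith_gradAvg.continuous.measurable.comp hs.meas_x
  refine ⟨(hp.continuous.measurable.comp (hs.meas_x.sub (hg.const_smul (η (k + 1))))).const_sub _,
    ?_⟩
  have h1 : MemLp (fun ω => prox (η (k + 1)) A.ψ
      ((run A η x0 D k ω).x - η (k + 1) • A.gradAvg (run A η x0 D k ω).x)) 2 P :=
    memLp_comp_lipschitz hp (hs.memLp_x.sub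
      ((memLp_comp_lipschitz A.lipschitzWith_gradAvg hs.memLp_x).const_smul (η (k + 1))))
  exact (memLp_const A.xstar).sub h1

/-- Descent of the iterates in expectation. The part of the error that is linear in the estimator
has mean zero, and the rest is its variance. -/
lemma descent (h : IsRun A m σ P x0 D η) {k : ℕ}
    (hs : IsRegular A P (history x0 D k) (run A η x0 D k)) :
    Integrable (fun ω => A.subopt (run A η x0 D (k + 1) ω).x) P ∧
    η (k + 1) * ∫ ω, A.subopt (run A η x0 D (k + 1) ω).x ∂P
        + ∫ ω, ‖(run A η x0 D (k + 1) ω).x - A.xstar‖ ^ 2 / 2 ∂P ≤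
      (1 - A.μ * η (k + 1)) * ∫ ω, ‖(run A η x0 D k ω).x - A.xstar‖ ^ 2 / 2 ∂P
        + η (k + 1) ^ 2 * (A.rhoQ * σ ^ 2 + 4 * A.LQ * ∫ ω, A.subopt (run A η x0 D k ω).x ∂P
          + 2 * ∫ ω, A.tableDist (run A η x0 D k ω).z ∂P) := by
  have hη := h.step_pos (k + 1)
  have hS := h.isSample hs
  obtain ⟨hYm, hY2⟩ := h.noiseless_step hs
  set t := η (k + 1) with ht
  set Y := fun ω => A.xstar - prox t A.ψ
      ((run A η x0 D k ω).x - t • A.gradAvg (run A η x0 D k ω).x) with hYdef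
  set err := fun ω => estimate A η x0 D k ω - A.gradAvg (run A η x0 D k ω).x with herr
  have herr2 : MemLp err 2 P := hS.memLp_error_draw
  have hstep : ∀ ω, t * A.subopt (run A η x0 D (k + 1) ω).x
      + ‖(run A η x0 D (k + 1) ω).x - A.xstar‖ ^ 2 / 2 ≤
      (1 - A.μ * t) * (‖(run A η x0 D k ω).x - A.xstar‖ ^ 2 / 2) + t * ⟪Y ω, err ω⟫
        + t ^ 2 * ‖err ω‖ ^ 2 := fun ω =>
    A.prox_step hη ((h.step_mul_LQ_le (k + 1)).trans (by norm_num)) _ _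
  have hdist : Integrable (fun ω => ‖(run A η x0 D k ω).x - A.xstar‖ ^ 2 / 2) P :=
    ((hs.memLp_x.sub (memLp_const _)).integrable_norm_pow two_ne_zero).div_const 2
  have hdist' : Integrable (fun ω => ‖(run A η x0 D (k + 1) ω).x - A.xstar‖ ^ 2 / 2) P :=
    (((h.memLp_succ_x hs).sub (memLp_const _)).integrable_norm_pow two_ne_zero).div_const 2
  have hYe : Integrable (fun ω => ⟪Y ω, err ω⟫) P := integrable_inner_of_memLp hY2 herr2
  have he2 : Integrable (fun ω => ‖err ω‖ ^ 2) P := herr2.integrable_norm_pow two_ne_zero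
  have hR1 := (hdist.const_mul (1 - A.μ * t)).add (hYe.const_mul t)
  have hR := hR1.add (he2.const_mul (t ^ 2))
  have hdom : ∀ ω, A.ψ (run A η x0 D (k + 1) ω).x ≠ ⊤ := fun ω => A.prox_mem hη _
  have hint : Integrable (fun ω => A.subopt (run A η x0 D (k + 1) ω).x) P := by
    refine (hR.const_mul (1 / t)).mono' (A.measurable_subopt.comp_aemeasurable
      (h.memLp_succ_x hs).aestronglyMeasurable.aemeasurable).aestronglyMeasurable
      (ae_of_all _ fun ω => ?_)
    rw [Real.norm_of_nonneg (A.subopt_nonneg (hdom ω))]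
    simp only [Pi.add_apply]
    have h1 := hstep ω
    have h2 : 0 ≤ ‖(run A η x0 D (k + 1) ω).x - A.xstar‖ ^ 2 / 2 := by positivity
    rw [one_div, inv_mul_eq_div, le_div_iff₀ hη]
    linarith
  refine ⟨hint, ?_⟩
  have hmono := integral_mono ((hint.const_mul t).add hdist') hR hstep
  have hl : ∫ ω, ((fun ω => t * A.subopt (run A η x0 D (k + 1) ω).x : Ω → ℝ)
      + (fun ω => ‖(run A η x0 D (k + 1) ω).x - A.xstar‖ ^ 2 / 2 : Ω → ℝ)) ω ∂P
      = t * ∫ ω, A.subopt (run A η x0 D (k + 1) ω).x ∂P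
        + ∫ ω, ‖(run A η x0 D (k + 1) ω).x - A.xstar‖ ^ 2 / 2 ∂P := by
    rw [integral_add' (hint.const_mul t) hdist', integral_const_mul]
  rw [hl, integral_add' hR1 (he2.const_mul _),
    integral_add' (hdist.const_mul _) (hYe.const_mul t), integral_const_mul, integral_const_mul,
    integral_const_mul, hS.integral_inner_error hYm hY2, mul_zero, add_zero] at hmono
  refine hmono.trans ?_
  gcongr
  exact hS.integral_sq_error_le hs.dom_x hs.int_x

lemma isRegular_succ (h : IsRun A m σ P x0 D η) {k : ℕ}
    (hs : IsRegular A P (history x0 D k) (run A η x0 D k)) :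
    IsRegular A P (history x0 D (k + 1)) (run A η x0 D (k + 1)) := by
  have hle : histTable x0 D k ≤ history x0 D (k + 1) := le_sup_left
  have hle0 : history x0 D k ≤ history x0 D (k + 1) :=
    ((le_sup_left.trans le_sup_left).trans le_sup_left).trans hle
  have hxT : Measurable[histTable x0 D k] fun ω => (run A η x0 D (k + 1) ω).x :=
    (h.measurable_succ_x hs).mono le_sup_left le_rfl
  have hx := hxT.mono hle le_rfl
  have hdom : ∀ ω, A.ψ (run A η x0 D (k + 1) ω).x ≠ ⊤ := fun ω => A.prox_mem (h.step_pos _) _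
  have hconv := fun ω => A.subopt_convex (hs.dom_xhat ω) (hdom ω) (h.tau_nonneg (k + 1))
    (h.tau_le_one (k + 1))
  have hxhat : Measurable[history x0 D (k + 1)] fun ω => (run A η x0 D (k + 1) ω).xhat := by
    simp_rw [h.run_succ_xhat]
    exact ((hs.meas_xhat.mono hle0 le_rfl).const_smul (1 - A.μ * η (k + 1))).add
      (hx.const_smul (A.μ * η (k + 1)))
  have hdomhat : ∀ ω, A.ψ (run A η x0 D (k + 1) ω).xhat ≠ ⊤ := fun ω => by
    rw [h.run_succ_xhat]; exact (hconv ω).1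
  have hRmem : ∀ j, MeasurableSet[MeasurableSpace.comap (D.refresh (k + 1)) ⊤]
      {ω | j ∈ D.refresh (k + 1) ω} := fun j => ⟨{s | j ∈ s}, trivial, rfl⟩
  have hz2 := fun j => (memLp_comp_lipschitz (A.lipschitzWith_gradient j)
    (h.memLp_succ_x hs)).add (h.memLp_tableNoise (k + 1) j)
  exact
  { meas_x := hx
    meas_z := fun j => by
      simp_rw [run_succ_z]
      refine Measurable.ite ((le_sup_right : _ ≤ history x0 D (k + 1)) _ (hRmem j))
        ((measurable_gradient_comp hx A j).add
          ((measurable_tableNoise x0 D k j).mono hle le_rfl)) ((hs.meas_z j).mono hle0 le_rfl)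
    meas_xhat := hxhat
    dom_x := hdom
    dom_xhat := hdomhat
    memLp_x := h.memLp_succ_x hs
    memLp_z := fun j => by
      have hT := h.admissible.refresh_comap_le (k + 1) _ (hRmem j)
      refine (memLp_congr_ae (ae_of_all _ fun ω => ?_)).1
        (((hz2 j).indicator hT).add ((hs.memLp_z j).indicator hT.compl))
      rw [run_succ_z]
      by_cases hj : j ∈ D.refresh (k + 1) ω <;> simp [hj]
    int_x := (h.descent hs).1
    int_xhat := by
      refine ((hs.int_xhat.const_mul (1 - A.μ * η (k + 1))).add
        ((h.descent hs).1.const_mul (A.μ * η (k + 1)))).mono'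
        (A.measurable_subopt.comp
          (hxhat.mono (h.admissible.history_le h.measurable_x0 _) le_rfl)).aestronglyMeasurable
        (ae_of_all _ fun ω => ?_)
      rw [Real.norm_of_nonneg (A.subopt_nonneg (hdomhat ω)), h.run_succ_xhat]
      exact (hconv ω).2 }

lemma isRegular (h : IsRun A m σ P x0 D η) (k : ℕ) :
    IsRegular A P (history x0 D k) (run A η x0 D k) := by
  induction k with
  | zero => exact h.isRegular_zero
  | succ k ih => exact h.isRegular_succ ih

/-- Convexity of the objective along the averaging step. -/
lemma averaging (h : IsRun A m σ P x0 D η) (k : ℕ) :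
    ∫ ω, A.subopt (run A η x0 D (k + 1) ω).xhat ∂P ≤
      (1 - A.μ * η (k + 1)) * ∫ ω, A.subopt (run A η x0 D k ω).xhat ∂P
        + A.μ * η (k + 1) * ∫ ω, A.subopt (run A η x0 D (k + 1) ω).x ∂P := by
  have h0 := h.isRegular k
  have h1 := h.isRegular (k + 1)
  rw [← integral_const_mul, ← integral_const_mul,
    ← integral_add (h0.int_xhat.const_mul _) (h1.int_x.const_mul _)]
  refine integral_mono h1.int_xhat ((h0.int_xhat.const_mul _).add (h1.int_x.const_mul _))
    fun ω => ?_
  rw [h.run_succ_xhat]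
  exact (A.subopt_convex (h0.dom_xhat ω) (h1.dom_x ω) (h.tau_nonneg _) (h.tau_le_one _)).2

/-- The quality of the table improves in expectation up to the current suboptimality. -/
lemma table_recursion (h : IsRun A m σ P x0 D η) (k : ℕ) :
    ∫ ω, A.tableDist (run A η x0 D (k + 1) ω).z ∂P ≤
      (1 - 1 / n) * ∫ ω, A.tableDist (run A η x0 D k ω).z ∂P
        + 1 / n * (2 * A.LQ * ∫ ω, A.subopt (run A η x0 D (k + 1) ω).x ∂P + A.rhoQ * σ ^ 2) := by
  have hs := h.isRegular k
  have hs' := h.isRegular (k + 1)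
  have hleT := h.admissible.histTable_le h.measurable_x0 k
  have hxI := h.measurable_succ_x hs
  have hxT : Measurable[histTable x0 D k] fun ω => (run A η x0 D (k + 1) ω).x :=
    hxI.mono le_sup_left le_rfl
  have hRmem : ∀ j, MeasurableSet[MeasurableSpace.comap (D.refresh (k + 1)) ⊤]
      {ω | j ∈ D.refresh (k + 1) ω} := fun j => ⟨{s | j ∈ s}, trivial, rfl⟩
  have h1 := (A.integral_tableDist_refresh hleT (h.admissible.refresh_comap_le (k + 1))
    (h.admissible.refresh_indep k) hRmem (h.admissible.refresh_law k).probReal_mem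
    (y := fun i ω => gradient (A.f i) (run A η x0 D (k + 1) ω).x + D.tableNoise (k + 1) i ω)
    (z := fun i ω => (run A η x0 D k ω).z i)
    (fun i => (measurable_gradient_comp hxT A i).add (measurable_tableNoise x0 D k i))
    (fun i => (hs.meas_z i).mono ((le_sup_left.trans le_sup_left).trans le_sup_left) le_rfl)
    (fun i => (memLp_comp_lipschitz (A.lipschitzWith_gradient i) hs'.memLp_x).add
      (h.memLp_tableNoise (k + 1) i)) hs.memLp_z).2
  have h2 := A.integral_tableDist_fresh_le (σ := σ) ((le_sup_left.trans hleT : histIdx x0 D k ≤ mΩ))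
    hxI hs'.memLp_x hs'.dom_x hs'.int_x (h.memLp_tableNoise (k + 1))
    (h.integral_tableNoise_le (k + 1)) (h.admissible.table_mean k)
  refine (le_of_eq h1).trans ?_
  gcongr

lemma table_zero (h : IsRun A m σ P x0 D η) :
    ∫ ω, A.tableDist (run A η x0 D 0 ω).z ∂P ≤
      2 * A.LQ * ∫ ω, A.subopt (x0 ω) ∂P + A.rhoQ * σ ^ 2 :=
  A.integral_tableDist_fresh_le h.measurable_x0.comap_le (comap_measurable x0) h.memLp_x0
    h.mem_dom h.integrable (h.memLp_tableNoise 0) (h.integral_tableNoise_le 0)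
    h.admissible.init_mean

end IsRun

end Run

/-! ### Rates of convergence -/

section Rates

variable {p n : ℕ} {Ω : Type*} {mΩ : MeasurableSpace Ω} {P : Measure Ω} [IsProbabilityMeasure P]
  {A : FiniteSumProblem p n} {m : Method} {σ : ℝ} {x0 : Ω → Vec p} {D : Draws p n Ω} {η : ℕ → ℝ}

/-- The Lyapunov function: expected suboptimality of the average, plus multiples of the expected
squared distance to the minimizer, of the expected quality of the table and of the expected
suboptimality of the last iterate. The factor `15` makes the table term absorb its contribution to
the variance of the estimator, at the expense of a part of the coefficient `6`. -/
noncomputable def energy (A : FiniteSumProblem p n) (P : Measure Ω) (x0 : Ω → Vec p)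
    (D : Draws p n Ω) (η : ℕ → ℝ) (k : ℕ) : ℝ :=
  ∫ ω, A.subopt (run A η x0 D k ω).xhat ∂P
    + 6 * A.μ * ∫ ω, ‖(run A η x0 D k ω).x - A.xstar‖ ^ 2 / 2 ∂P
    + 15 * A.μ * η k ^ 2 * n * ∫ ω, A.tableDist (run A η x0 D k ω).z ∂P
    + 5 / 2 * A.μ * η k * ∫ ω, A.subopt (run A η x0 D k ω).x ∂P

namespace FiniteSumProblem

lemma tableDist_nonneg (A : FiniteSumProblem p n) (v : Fin n → Vec p) : 0 ≤ A.tableDist v :=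
  mul_nonneg (by positivity) (Finset.sum_nonneg fun i _ =>
    mul_nonneg (one_div_nonneg.2 (A.qn_pos i).le) (by positivity))

end FiniteSumProblem

/-- The algebra behind the decrease of the Lyapunov function; primes mark the new iteration. -/
lemma energy_step_aux {n μ L N η η' a a' d d' h h' t t' : ℝ} (hn : 1 ≤ n) (hμ : 0 < μ)
    (hη' : 0 < η') (hηη' : η' ≤ η) (hδ : μ * η' * n ≤ 1 / 5) (hL : η' * L ≤ 1 / 12)
    (ha : 0 ≤ a) (ha' : 0 ≤ a') (ht : 0 ≤ t)
    (h1 : η' * a' + d' ≤ (1 - μ * η') * d + η' ^ 2 * (N + 4 * L * a + 2 * t))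
    (h2 : t' ≤ (1 - 1 / n) * t + 1 / n * (2 * L * a' + N))
    (h3 : h' ≤ (1 - μ * η') * h + μ * η' * a') :
    h' + 6 * μ * d' + 15 * μ * η' ^ 2 * n * t' + 5 / 2 * μ * η' * a' ≤
      (1 - μ * η') * (h + 6 * μ * d + 15 * μ * η ^ 2 * n * t + 5 / 2 * μ * η * a)
        + 21 * (μ * η') * η' * N := by
  have hδ0 : 0 < μ * η' := mul_pos hμ hη'
  have hδ1 : μ * η' ≤ 1 / 5 := by nlinarith
  have h1' := mul_le_mul_of_nonneg_left h1 (by positivity : 0 ≤ 6 * μ)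
  have h2' := mul_le_mul_of_nonneg_left h2 (by positivity : 0 ≤ 15 * μ * η' ^ 2 * n)
  have e2 : 15 * μ * η' ^ 2 * n * ((1 - 1 / n) * t + 1 / n * (2 * L * a' + N))
      = 15 * μ * η' ^ 2 * (n - 1) * t + 15 * μ * η' ^ 2 * (2 * L * a' + N) := by
    field_simp
  rw [e2] at h2'
  -- the new suboptimality has a negative total coefficient
  have ea' : 30 * (μ * η') * (η' * L) * a' ≤ 5 / 2 * (μ * η') * a' := by
    have := mul_le_mul_of_nonneg_left hL (mul_nonneg hδ0.le ha')
    nlinarith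
  -- the old suboptimality
  have ea : 24 * (μ * η') * (η' * L) * a ≤ (1 - μ * η') * (5 / 2 * μ * η * a) := by
    have s1 := mul_le_mul_of_nonneg_left hL (mul_nonneg hδ0.le ha)
    have s2 : 4 / 5 * (5 / 2 * μ * η' * a) ≤ (1 - μ * η') * (5 / 2 * μ * η * a) := by
      have : (4 : ℝ) / 5 ≤ 1 - μ * η' := by linarith
      gcongr
    nlinarith
  -- the old table
  have et : 15 * μ * η' ^ 2 * (n - 1) * t + 12 * μ * η' ^ 2 * t
      ≤ (1 - μ * η') * (15 * μ * η ^ 2 * n * t) := by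
    have s1 : 15 * μ * η' ^ 2 * (n - 1) * t + 12 * μ * η' ^ 2 * t
        ≤ (1 - μ * η') * (15 * μ * η' ^ 2 * n * t) := by
      have : 0 ≤ 15 * (μ * η' ^ 2 * t) * (1 / 5 - μ * η' * n) :=
        mul_nonneg (by positivity) (by linarith)
      linarith
    refine s1.trans ?_
    have : 0 ≤ 1 - μ * η' := by linarith
    gcongr
  linarith

namespace IsRun

lemma energy_succ (h : IsRun A m σ P x0 D η) {k : ℕ} (hanti : η (k + 1) ≤ η k) :
    energy A P x0 D η (k + 1) ≤ (1 - A.μ * η (k + 1)) * energy A P x0 D η k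
      + 21 * (A.μ * η (k + 1)) * η (k + 1) * (A.rhoQ * σ ^ 2) := by
  have hn := A.cast_n_pos
  refine energy_step_aux (L := A.LQ) (by exact_mod_cast A.n_pos) A.μ_pos (h.step_pos _) hanti ?_
    (h.step_mul_LQ_le _) (integral_nonneg fun ω => A.subopt_nonneg ((h.isRegular k).dom_x ω))
    (integral_nonneg fun ω => A.subopt_nonneg ((h.isRegular (k + 1)).dom_x ω))
    (integral_nonneg fun ω => A.tableDist_nonneg _) (h.descent (h.isRegular k)).2
    (h.table_recursion k) (h.averaging k)
  have := h.tau_le (k + 1)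
  rw [le_div_iff₀ (by positivity)] at this
  linarith

lemma energy_zero_le (h : IsRun A m σ P x0 D η) :
    energy A P x0 D η 0 ≤ 8 * ∫ ω, A.subopt (x0 ω) ∂P + 3 * A.eta * (A.rhoQ * σ ^ 2) := by
  have hμ := A.μ_pos
  have hη := h.step_pos 0
  have hn : (1 : ℝ) ≤ n := by exact_mod_cast A.n_pos
  have hΔ : 0 ≤ ∫ ω, A.subopt (x0 ω) ∂P := integral_nonneg fun ω => A.subopt_nonneg (h.mem_dom ω)
  have hd : A.μ * ∫ ω, ‖x0 ω - A.xstar‖ ^ 2 / 2 ∂P ≤ ∫ ω, A.subopt (x0 ω) ∂P := by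
    rw [← integral_const_mul]
    refine integral_mono ((((h.memLp_x0.sub (memLp_const _)).integrable_norm_pow
      two_ne_zero).div_const 2).const_mul _) h.integrable fun ω => ?_
    refine le_trans (le_of_eq ?_) (A.sq_dist_xstar_le (h.mem_dom ω))
    ring
  have hδ : A.μ * η 0 * n ≤ 1 / 5 := by
    have := h.tau_le 0
    rw [le_div_iff₀ (by positivity)] at this
    linarith
  have hN : 0 ≤ A.rhoQ * σ ^ 2 := mul_nonneg A.rhoQ_pos_and_le.1.le (sq_nonneg σ)
  have ht : 15 * A.μ * η 0 ^ 2 * n * ∫ ω, A.tableDist (run A η x0 D 0 ω).z ∂P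
      ≤ 1 / 2 * ∫ ω, A.subopt (x0 ω) ∂P + 3 * A.eta * (A.rhoQ * σ ^ 2) := by
    have hb : 0 ≤ 2 * A.LQ * ∫ ω, A.subopt (x0 ω) ∂P + A.rhoQ * σ ^ 2 := by
      have := A.LQ_pos; positivity
    calc 15 * A.μ * η 0 ^ 2 * n * ∫ ω, A.tableDist (run A η x0 D 0 ω).z ∂P
        ≤ 15 * A.μ * η 0 ^ 2 * n * (2 * A.LQ * ∫ ω, A.subopt (x0 ω) ∂P + A.rhoQ * σ ^ 2) := by
          gcongr; exact h.table_zero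
      _ = (A.μ * η 0 * n) *
          (15 * η 0 * (2 * A.LQ * ∫ ω, A.subopt (x0 ω) ∂P + A.rhoQ * σ ^ 2)) := by ring
      _ ≤ 1 / 5 * (15 * η 0 * (2 * A.LQ * ∫ ω, A.subopt (x0 ω) ∂P + A.rhoQ * σ ^ 2)) := by
          gcongr
      _ = 6 * (η 0 * A.LQ) * ∫ ω, A.subopt (x0 ω) ∂P + 3 * η 0 * (A.rhoQ * σ ^ 2) := by ring
      _ ≤ 6 * (1 / 12) * ∫ ω, A.subopt (x0 ω) ∂P + 3 * A.eta * (A.rhoQ * σ ^ 2) := by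
          gcongr
          · exact h.step_mul_LQ_le 0
          · exact h.step_le 0
      _ = _ := by ring
  have ha : 5 / 2 * A.μ * η 0 * ∫ ω, A.subopt (x0 ω) ∂P ≤ 1 / 2 * ∫ ω, A.subopt (x0 ω) ∂P := by
    have : A.μ * η 0 ≤ 1 / 5 := by
      have : 0 < A.μ * η 0 := mul_pos hμ hη
      nlinarith
    gcongr
    linarith
  have e : energy A P x0 D η 0 = ∫ ω, A.subopt (x0 ω) ∂P
      + 6 * A.μ * ∫ ω, ‖x0 ω - A.xstar‖ ^ 2 / 2 ∂P
      + 15 * A.μ * η 0 ^ 2 * n * ∫ ω, A.tableDist (run A η x0 D 0 ω).z ∂P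
      + 5 / 2 * A.μ * η 0 * ∫ ω, A.subopt (x0 ω) ∂P := rfl
  rw [e]
  linarith

lemma integral_subopt_le_energy (h : IsRun A m σ P x0 D η) (k : ℕ) :
    ∫ ω, A.subopt (run A η x0 D k ω).xhat ∂P ≤ energy A P x0 D η k := by
  have h1 : 0 ≤ ∫ ω, ‖(run A η x0 D k ω).x - A.xstar‖ ^ 2 / 2 ∂P :=
    integral_nonneg fun ω => by positivity
  have h2 : 0 ≤ ∫ ω, A.tableDist (run A η x0 D k ω).z ∂P :=
    integral_nonneg fun ω => A.tableDist_nonneg _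
  have h3 : 0 ≤ ∫ ω, A.subopt (run A η x0 D k ω).x ∂P :=
    integral_nonneg fun ω => A.subopt_nonneg ((h.isRegular k).dom_x ω)
  have hμ := A.μ_pos
  have hη := h.step_pos k
  unfold energy
  have h4 : 0 ≤ 6 * A.μ * ∫ ω, ‖(run A η x0 D k ω).x - A.xstar‖ ^ 2 / 2 ∂P := by positivity
  have h5 : 0 ≤ 15 * A.μ * η k ^ 2 * n * ∫ ω, A.tableDist (run A η x0 D k ω).z ∂P := by positivity
  have h6 : 0 ≤ 5 / 2 * A.μ * η k * ∫ ω, A.subopt (run A η x0 D k ω).x ∂P := by positivity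
  linarith

lemma lintegral_gap_eq (h : IsRun A m σ P x0 D η) (k : ℕ) :
    ∫⁻ ω, A.gap (run A η x0 D k ω).xhat ∂P
      = ENNReal.ofReal (∫ ω, A.subopt (run A η x0 D k ω).xhat ∂P) := by
  have hs := h.isRegular k
  rw [ofReal_integral_eq_lintegral_ofReal hs.int_xhat
    (ae_of_all _ fun ω => A.subopt_nonneg (hs.dom_xhat ω))]
  exact lintegral_congr fun ω => A.gap_eq (hs.dom_xhat ω)

/-- Linear convergence with the constant step, up to a noise level proportional to the step. -/
lemma constant_step_rate (h : IsRun A m σ P x0 D fun _ => A.eta) (k : ℕ) :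
    ∫ ω, A.subopt (run A (fun _ => A.eta) x0 D k ω).xhat ∂P ≤
      (1 - A.μ * A.eta) ^ k * (8 * ∫ ω, A.subopt (x0 ω) ∂P)
        + 21 * A.eta * (A.rhoQ * σ ^ 2) := by
  have hN : 0 ≤ A.eta * (A.rhoQ * σ ^ 2) :=
    mul_nonneg A.eta_pos.le (mul_nonneg A.rhoQ_pos_and_le.1.le (sq_nonneg σ))
  refine (h.integral_subopt_le_energy k).trans ?_
  induction k with
  | zero =>
    have := h.energy_zero_le
    rw [pow_zero, one_mul]
    linarith
  | succ k ih =>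
    have h1 := h.energy_succ (k := k) le_rfl
    have h2 : 0 ≤ 1 - A.μ * A.eta := sub_nonneg.2 (h.tau_le_one k)
    have h3 := mul_le_mul_of_nonneg_left ih h2
    rw [pow_succ]
    linarith

end IsRun

lemma FiniteSumProblem.etaDecr_pos (A : FiniteSumProblem p n) (k : ℕ) : 0 < A.etaDecr k :=
  lt_min A.eta_pos (div_pos two_pos (mul_pos A.μ_pos (by positivity)))

lemma FiniteSumProblem.etaDecr_succ_le (A : FiniteSumProblem p n) (k : ℕ) :
    A.etaDecr (k + 1) ≤ A.etaDecr k := by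
  have hμ := A.μ_pos
  unfold etaDecr
  gcongr
  simp

/-- With decreasing steps the expected suboptimality is of order `1 / k`. As long as the step is
still `η`, the bound holds because the initial accuracy is of order `η`; afterwards it is
propagated by the recursion. -/
lemma IsRun.decreasing_step_rate (h : IsRun A m σ P x0 D A.etaDecr)
    (h0 : ∫ ω, A.subopt (x0 ω) ∂P ≤ 24 * A.rhoQ * A.eta * σ ^ 2) (k : ℕ) :
    ∫ ω, A.subopt (run A A.etaDecr x0 D k ω).xhat ∂P ≤
      390 * (A.rhoQ * σ ^ 2) / (A.μ * (k + 2)) := by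
  have hμ := A.μ_pos
  have hη := A.eta_pos
  set N := A.rhoQ * σ ^ 2 with hNdef
  have hN : 0 ≤ N := mul_nonneg A.rhoQ_pos_and_le.1.le (sq_nonneg σ)
  have hV : ∀ k, energy A P x0 D A.etaDecr k ≤ 195 * A.eta * N := by
    intro k
    induction k with
    | zero =>
      have := h.energy_zero_le
      have e : 24 * A.rhoQ * A.eta * σ ^ 2 = 24 * A.eta * N := by rw [hNdef]; ring
      rw [e] at h0
      linarith
    | succ k ih =>
      have h1 := h.energy_succ (A.etaDecr_succ_le k)
      have h2 : 0 ≤ 1 - A.μ * A.etaDecr (k + 1) := sub_nonneg.2 (h.tau_le_one (k + 1))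
      have h3 := mul_le_mul_of_nonneg_left ih h2
      have h4 : 21 * (A.μ * A.etaDecr (k + 1)) * A.etaDecr (k + 1) * N
          ≤ 21 * (A.μ * A.etaDecr (k + 1)) * A.eta * N := by
        have := A.etaDecr_pos (k + 1)
        gcongr
        exact h.step_le (k + 1)
      have h5 : 0 ≤ A.μ * A.etaDecr (k + 1) * A.eta * N := by
        have := A.etaDecr_pos (k + 1)
        positivity
      linarith
  have hearly : ∀ k : ℕ, A.eta ≤ 2 / (A.μ * (k + 2)) →
      energy A P x0 D A.etaDecr k ≤ 390 * N / (A.μ * (k + 2)) := by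
    intro k hk
    calc energy A P x0 D A.etaDecr k ≤ 195 * A.eta * N := hV k
      _ ≤ 195 * (2 / (A.μ * (k + 2))) * N := by gcongr
      _ = 390 * N / (A.μ * (k + 2)) := by ring
  refine (h.integral_subopt_le_energy k).trans ?_
  induction k with
  | zero =>
    refine hearly 0 ?_
    rw [le_div_iff₀ (by positivity)]
    have h1 := A.mu_mul_eta_mul_n_le
    have hn : (1 : ℝ) ≤ n := by exact_mod_cast A.n_pos
    have : 0 < A.μ * A.eta := by positivity
    push_cast
    nlinarith
  | succ k ih =>
    rcases le_total A.eta (2 / (A.μ * ((k + 1 : ℕ) + 2))) with hk | hk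
    · exact hearly _ hk
    have hstep : A.etaDecr (k + 1) = 2 / (A.μ * ((k + 1 : ℕ) + 2)) := min_eq_right hk
    have h1 := h.energy_succ (A.etaDecr_succ_le k)
    have h2 : 0 ≤ 1 - A.μ * A.etaDecr (k + 1) := sub_nonneg.2 (h.tau_le_one (k + 1))
    have h3 := mul_le_mul_of_nonneg_left ih h2
    refine (h1.trans (add_le_add_left h3 _)).trans ?_
    rw [hstep]
    push_cast
    have e : (1 - A.μ * (2 / (A.μ * ((k : ℝ) + 1 + 2)))) * (390 * N / (A.μ * (k + 2)))
        + 21 * (A.μ * (2 / (A.μ * ((k : ℝ) + 1 + 2)))) * (2 / (A.μ * (k + 1 + 2))) * N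
        = N / (A.μ * (k + 1 + 2)) * (390 * (k + 1) / (k + 2) + 84 / (k + 3)) := by
      field_simp
      ring
    rw [e]
    have h4 : 390 * ((k : ℝ) + 1) / (k + 2) + 84 / (k + 3) ≤ 390 := by
      rw [div_add_div _ _ (by positivity) (by positivity), div_le_iff₀ (by positivity)]
      nlinarith
    calc _ ≤ N / (A.μ * (k + 1 + 2)) * 390 := by gcongr
      _ = _ := by ring

end Rates

/-! ### Complexity -/

section Complexity

variable {p n : ℕ} {Ω : Type*} {mΩ : MeasurableSpace Ω} {P : Measure Ω}
  {A : FiniteSumProblem p n} {m : Method} {σ : ℝ} {x0 : Ω → Vec p} {D : Draws p n Ω}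

namespace Admissible

lemma measurable_card_refresh (h : Admissible A m σ P x0 D) (k : ℕ) :
    Measurable fun ω => (((D.refresh k ω).card : ℕ) : ℝ≥0∞) := by
  intro t _
  exact h.refresh_comap_le k _ ⟨{s | ((s.card : ℕ) : ℝ≥0∞) ∈ t}, trivial, rfl⟩

variable [IsProbabilityMeasure P]

/-- Each iteration refreshes one table entry in expectation. -/
lemma lintegral_card_refresh (h : Admissible A m σ P x0 D) (k : ℕ) :
    ∫⁻ ω, (((D.refresh (k + 1) ω).card : ℕ) : ℝ≥0∞) ∂P = 1 := by
  have hT : ∀ j, MeasurableSet {ω | j ∈ D.refresh (k + 1) ω} := fun j =>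
    h.refresh_comap_le (k + 1) _ ⟨{s | j ∈ s}, trivial, rfl⟩
  have e : ∀ ω, (((D.refresh (k + 1) ω).card : ℕ) : ℝ≥0∞)
      = ∑ j, {ω | j ∈ D.refresh (k + 1) ω}.indicator (fun _ => (1 : ℝ≥0∞)) ω := by
    intro ω
    simp [Set.indicator_apply]
  have hP : ∀ j, P {ω | j ∈ D.refresh (k + 1) ω} = ENNReal.ofReal (1 / n) := fun j => by
    rw [← (h.refresh_law k).probReal_mem j, ofReal_measureReal]
  simp_rw [e]
  rw [lintegral_finsetSum _ fun j _ => measurable_const.indicator (hT j)]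
  simp_rw [lintegral_indicator_const (hT _), hP]
  rw [Finset.sum_const, Finset.card_univ, Fintype.card_fin, nsmul_eq_mul, one_mul,
    ← ENNReal.ofReal_natCast, ← ENNReal.ofReal_mul (by positivity), mul_one_div,
    div_self A.cast_n_pos.ne', ENNReal.ofReal_one]

/-- The expected cost of a run: `n` evaluations at the start and at most three per iteration. -/
lemma lintegral_gradEvals_le (h : Admissible A m σ P x0 D) (K : ℕ) :
    Measurable (fun ω => ((gradEvals m D K ω : ℕ) : ℝ≥0∞)) ∧
      ∫⁻ ω, ((gradEvals m D K ω : ℕ) : ℝ≥0∞) ∂P ≤ n + 3 * K := by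
  obtain ⟨c, hc2, e⟩ : ∃ c : ℝ≥0∞, c ≤ 2 ∧ ∀ ω, ((gradEvals m D K ω : ℕ) : ℝ≥0∞)
      = n + ∑ k ∈ Finset.range K, (c + ((D.refresh (k + 1) ω).card : ℕ)) := by
    cases m with
    | randomSVRG => exact ⟨2, le_rfl, fun ω => by simp [gradEvals]⟩
    | saga => exact ⟨1, one_le_two, fun ω => by simp [gradEvals]⟩
  simp_rw [e]
  have hmeas : ∀ k, Measurable fun ω => c + ((D.refresh (k + 1) ω).card : ℕ) :=
    fun k => (h.measurable_card_refresh (k + 1)).const_add _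
  refine ⟨(Finset.measurable_fun_sum _ fun k _ => hmeas k).const_add _, ?_⟩
  rw [lintegral_add_left measurable_const, lintegral_finsetSum _ fun k _ => hmeas k]
  simp_rw [lintegral_add_left (measurable_const (a := c)), h.lintegral_card_refresh,
    lintegral_const, measure_univ, mul_one]
  rw [Finset.sum_const, Finset.card_range, nsmul_eq_mul, mul_comm (3 : ℝ≥0∞)]
  gcongr
  calc c + 1 ≤ 2 + 1 := by gcongr
    _ = 3 := by norm_num

end Admissible

/-- The number of iterations of the first stage: with `δ = μ η`, the linear rate reaches the noise
level after about `(1/δ) log (Δ/ε)` iterations. The constant `6` bounds `log 64`: it suffices that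
the factor `(1 - δ) ^ k` brings `8 Δ` down to `ε / 8 ≤ 3 M`. -/
lemma exists_first_stage_length {δ Δ ε M : ℝ} (hδ : 0 < δ) (hδ1 : δ ≤ 1) (hΔ : 0 ≤ Δ) (hε : 0 < ε)
    (hεM : ε ≤ 24 * M) :
    ∃ k : ℕ, (k : ℝ) ≤ (6 + max 0 (Real.log (Δ / ε))) / δ + 1 ∧
      (1 - δ) ^ k * (8 * Δ) + 21 * M ≤ 24 * M := by
  set l := max 0 (Real.log (Δ / ε)) with hl
  have hl0 : 0 ≤ l := le_max_left _ _
  refine ⟨⌈(6 + l) / δ⌉₊, (Nat.ceil_lt_add_one (by positivity)).le, ?_⟩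
  set k := ⌈(6 + l) / δ⌉₊ with hk
  have h1 : 6 + l ≤ δ * k := by
    have := Nat.le_ceil ((6 + l) / δ)
    rw [div_le_iff₀ hδ] at this
    linarith
  have h2 : (1 - δ) ^ k ≤ Real.exp (-(6 + l)) := by
    calc (1 - δ) ^ k ≤ (Real.exp (-δ)) ^ k := by
          have := Real.one_sub_le_exp_neg δ
          have : 0 ≤ 1 - δ := by linarith
          gcongr
      _ = Real.exp (-(δ * k)) := by rw [← Real.exp_nat_mul]; ring_nf
      _ ≤ _ := by gcongr
  have h3 : Δ ≤ ε * Real.exp l := by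
    rcases hΔ.eq_or_lt with h0 | h0
    · rw [← h0]; positivity
    · have : Δ / ε ≤ Real.exp l := by
        rw [← Real.log_le_iff_le_exp (by positivity)]
        exact le_max_right _ _
      rwa [div_le_iff₀ hε, mul_comm] at this
  have h4 : (64 : ℝ) ≤ Real.exp 6 := by
    have h : (2 : ℝ) ≤ Real.exp 1 := by linarith [Real.add_one_le_exp (1 : ℝ)]
    calc (64 : ℝ) = 2 ^ 6 := by norm_num
      _ ≤ Real.exp 1 ^ 6 := by gcongr
      _ = Real.exp 6 := by rw [← Real.exp_nat_mul]; norm_num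
  have h5 : (1 - δ) ^ k * (8 * Δ) ≤ ε / 8 := by
    calc (1 - δ) ^ k * (8 * Δ) ≤ Real.exp (-(6 + l)) * (8 * (ε * Real.exp l)) := by gcongr
      _ = 8 * ε / Real.exp 6 := by
        rw [neg_add, Real.exp_add, Real.exp_neg, Real.exp_neg]
        field_simp
      _ ≤ 8 * ε / 64 := by gcongr
      _ = ε / 8 := by ring
  linarith

/-- The total number of evaluations, in terms of the lengths of the two stages. -/
lemma total_cost_le {n κ δ X l K₁ K₂ : ℝ} (hn : 1 ≤ n) (hδ : 0 < δ) (hl : 0 ≤ l)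
    (hκ : 0 ≤ κ) (hδn : δ * n ≤ 1 / 5) (hδκ : 1 / δ ≤ 12 * κ + 5 * n) (hδX : 1 / δ ≤ 24 * X)
    (h1 : K₁ ≤ (6 + l) / δ + 1) (h2 : K₂ ≤ 390 * X + 1) :
    n + 3 * K₁ + (n + 3 * K₂) ≤ 2000 * ((n + κ) * l) + 2000 * X := by
  have e : (6 + l) / δ = 6 * (1 / δ) + 1 / δ * l := by ring
  have hδl : 1 / δ * l ≤ (12 * κ + 5 * n) * l := by gcongr
  have hnδ : n ≤ 1 / δ := by
    rw [le_div_iff₀ hδ]; linarith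
  have : 0 ≤ κ * l := by positivity
  have : 0 ≤ n * l := by positivity
  rw [e] at h1
  linarith

lemma FiniteSumProblem.one_div_mu_mul_eta_le (A : FiniteSumProblem p n) :
    1 / (A.μ * A.eta) ≤ 12 * (A.LQ / A.μ) + 5 * n := by
  have hμ := A.μ_pos
  have hL := A.LQ_pos
  have hn := A.cast_n_pos
  rcases min_choice (1 / (12 * A.LQ)) (1 / (5 * A.μ * n)) with h | h
  · have e : 1 / (A.μ * A.eta) = 12 * (A.LQ / A.μ) := by
      rw [eta, h]; field_simp
    rw [e]; linarith
  · have e : 1 / (A.μ * A.eta) = 5 * n := by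
      rw [eta, h]; field_simp
    rw [e]
    have : 0 ≤ A.LQ / A.μ := by positivity
    linarith

end Complexity

end StochasticVR

theorem mainTheorem3 :
    ∃ C : ℝ, 0 < C ∧
      ∀ (p n : ℕ) (A : StochasticVR.FiniteSumProblem p n) (m : StochasticVR.Method)
        (σ ε : ℝ) (x₀ : StochasticVR.Vec p),
        A.ψ x₀ ≠ ⊤ → 0 < ε → ε ≤ 24 * A.rhoQ * A.eta * σ ^ 2 →
      ∀ (Ω : Type*) (mΩ : MeasurableSpace Ω) (P : Measure Ω), IsProbabilityMeasure P →
      ∀ D₁ : StochasticVR.Draws p n Ω,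
        StochasticVR.Admissible A m σ P (fun _ => x₀) D₁ →
      ∃ K₁ : ℕ,
        IsLeast {k : ℕ |
          ∫⁻ ω, A.gap (StochasticVR.run A (fun _ => A.eta) (fun _ => x₀) D₁ k ω).xhat ∂P
            ≤ ENNReal.ofReal (24 * A.rhoQ * A.eta * σ ^ 2)} K₁ ∧
        ∃ K₂ : ℕ, ∀ D₂ : StochasticVR.Draws p n Ω,
          StochasticVR.Admissible A m σ P
            (fun ω =>
              (StochasticVR.run A (fun _ => A.eta) (fun _ => x₀) D₁ K₁ ω).xhat) D₂ →
          (∀ k, K₂ ≤ k →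
            ∫⁻ ω, A.gap (StochasticVR.run A A.etaDecr
              (fun ω' =>
                (StochasticVR.run A (fun _ => A.eta) (fun _ => x₀) D₁ K₁ ω').xhat)
              D₂ k ω).xhat ∂P ≤ ENNReal.ofReal ε) ∧
          ∫⁻ ω, ((StochasticVR.gradEvals m D₁ K₁ ω + StochasticVR.gradEvals m D₂ K₂ ω : ℕ)
              : ℝ≥0∞) ∂P
            ≤ ENNReal.ofReal
              (C * ((n + A.LQ / A.μ) * max 0 (Real.log ((A.gap x₀).toReal / ε)))
                + C * (A.rhoQ * σ ^ 2 / (A.μ * ε))) := by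
  refine ⟨2000, by norm_num, ?_⟩
  intro p n A m σ ε x₀ hx₀ hε hε' Ω mΩ P hP D₁ hD₁
  have hμ := A.μ_pos
  have hη := A.eta_pos
  have hn : (1 : ℝ) ≤ n := by exact_mod_cast A.n_pos
  have hρ := A.rhoQ_pos_and_le.1
  have hrun : StochasticVR.IsRun A m σ P (fun _ => x₀) D₁ fun _ => A.eta :=
    { admissible := hD₁
      measurable_x0 := measurable_const
      mem_dom := fun _ => hx₀
      integrable := integrable_const _
      step_pos := fun _ => hη
      step_le := fun _ => le_rfl }
  have hδ : 0 < A.μ * A.eta := mul_pos hμ hη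
  have hM : 24 * A.rhoQ * A.eta * σ ^ 2 = 24 * (A.eta * (A.rhoQ * σ ^ 2)) := by ring
  obtain ⟨k₁, hk₁, hk₁'⟩ := StochasticVR.exists_first_stage_length hδ (hrun.tau_le_one 0)
    (A.subopt_nonneg hx₀) hε (hε'.trans_eq hM)
  set S := {k : ℕ |
          ∫⁻ ω, A.gap (StochasticVR.run A (fun _ => A.eta) (fun _ => x₀) D₁ k ω).xhat ∂P
            ≤ ENNReal.ofReal (24 * A.rhoQ * A.eta * σ ^ 2)} with hS
  have hk₁S : k₁ ∈ S := by
    rw [hS, Set.mem_ofPred_eq, hrun.lintegral_gap_eq]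
    refine ENNReal.ofReal_le_ofReal ((hrun.constant_step_rate k₁).trans ?_)
    rw [integral_const, probReal_univ, one_smul, hM]
    linarith
  refine ⟨sInf S, ⟨Nat.sInf_mem ⟨k₁, hk₁S⟩, fun k hk => Nat.sInf_le hk⟩, ?_⟩
  have hK₁ : ((sInf S : ℕ) : ℝ) ≤ k₁ := by exact_mod_cast Nat.sInf_le hk₁S
  have hmem : sInf S ∈ S := Nat.sInf_mem ⟨k₁, hk₁S⟩
  set K₁ := sInf S
  rw [hS, Set.mem_ofPred_eq, hrun.lintegral_gap_eq,
    ENNReal.ofReal_le_ofReal_iff (hε.le.trans hε')] at hmem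
  have hreg := hrun.isRegular K₁
  set X := A.rhoQ * σ ^ 2 / (A.μ * ε) with hX
  have hX0 : 0 ≤ X := by positivity
  refine ⟨⌈390 * X⌉₊, fun D₂ hD₂ => ?_⟩
  have hrun₂ : StochasticVR.IsRun A m σ P _ D₂ A.etaDecr :=
    { admissible := hD₂
      measurable_x0 := hreg.meas_xhat.mono (hD₁.history_le measurable_const K₁) le_rfl
      mem_dom := hreg.dom_xhat
      integrable := hreg.int_xhat
      step_pos := A.etaDecr_pos
      step_le := fun k => min_le_left _ _ }
  constructor
  · intro k hk
    rw [hrun₂.lintegral_gap_eq]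
    refine ENNReal.ofReal_le_ofReal ((hrun₂.decreasing_step_rate hmem k).trans ?_)
    have h1 : 390 * X ≤ k := (Nat.le_ceil _).trans (by exact_mod_cast hk)
    rw [div_le_iff₀ (by positivity)]
    calc 390 * (A.rhoQ * σ ^ 2) = ε * (A.μ * (390 * X)) := by rw [hX]; field_simp
      _ ≤ ε * (A.μ * (k + 2)) := by gcongr; linarith
  · obtain ⟨hm₁, hc₁⟩ := hD₁.lintegral_gradEvals_le K₁
    obtain ⟨-, hc₂⟩ := hD₂.lintegral_gradEvals_le ⌈390 * X⌉₊
    simp_rw [Nat.cast_add]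
    rw [lintegral_add_left hm₁]
    refine (add_le_add hc₁ hc₂).trans ?_
    have e : ((n : ℝ≥0∞) + 3 * (K₁ : ℕ)) + (n + 3 * (⌈390 * X⌉₊ : ℕ))
        = ENNReal.ofReal ((n + 3 * (K₁ : ℝ)) + (n + 3 * ((⌈390 * X⌉₊ : ℕ) : ℝ))) := by
      have e' : (n + 3 * (K₁ : ℝ)) + (n + 3 * ((⌈390 * X⌉₊ : ℕ) : ℝ))
        = (((n + 3 * K₁) + (n + 3 * ⌈390 * X⌉₊) : ℕ) : ℝ) := by push_cast; ring
      rw [e', ENNReal.ofReal_natCast]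
      push_cast
      ring
    rw [e, A.gap_eq hx₀, ENNReal.toReal_ofReal (A.subopt_nonneg hx₀)]
    refine ENNReal.ofReal_le_ofReal (StochasticVR.total_cost_le hn hδ (le_max_left _ _)
      (div_pos A.LQ_pos hμ).le A.mu_mul_eta_mul_n_le A.one_div_mu_mul_eta_le ?_
      (hK₁.trans hk₁) (Nat.ceil_lt_add_one (by positivity)).le)
    -- this is the upper bound on `ε`
    rw [hX, div_le_iff₀ hδ]
    have : 24 * (A.rhoQ * σ ^ 2 / (A.μ * ε)) * (A.μ * A.eta)
        = 24 * A.rhoQ * A.eta * σ ^ 2 / ε := by field_simp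
    rwa [this, one_le_div hε]
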